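/- Let $M$ be a connected, Hausdorff, second countable smooth manifold of dimension $n+1$, with a smooth Lorentzian metric $g$ of signature $(-,+,\dots,+)$ and a time orientation. A hypersurface of $M$ is a smooth embedded submanifold of codimension $1$ without boundary; it is spacelike if $g$ is positive definite on its tangent spaces. If $\nu$ is the future-pointing unit normal field of a spacelike hypersurface $\Sigma$ and $\nabla$ the Levi-Civita connection of $g$, the mean curvature of $\Sigma$ at $p$ is the trace (with respect to $g|_{T_p\Sigma}$) of the second fundamental form $II_p(X,Y)=-g(\nabla_X \nu,Y)$ on $T_p\Sigma$; $\Sigma$ is CMC if its mean curvature is constant. A Cauchy surface is a spacelike hypersurface that every inextendible non-spacelike curve meets exactly once. A CMC time function is a smooth submersion $\tau:M\to\mathbb{R}$ that is strictly increasing along every future-directed timelike curve and such that, for every $\theta\in\mathbb{R}$, the (possibly empty) fiber $\tau^{-1}(\theta)$ is a spacelike hypersurface of constant mean curvature $\theta$. Proposition. Assume that $M$ has a compact Cauchy surface (that is, $M$ is globally hyperbolic with compact Cauchy surfaces), and let $\tau:M\to\mathbb{R}$ be a CMC time function. Then every nonempty compact CMC spacelike hypersurface $\Sigma$ of $M$ is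 a fiber of $\tau$: there is $\theta\in\mathbb{R}$ with $\Sigma=\tau^{-1}(\theta)$. -/

import Mathlib

open Set Filter Topology Bundle Manifold
open scoped Manifold ContDiff

noncomputable section

namespace Spacetime

/-- The model space of an `(n + 1)`-dimensional manifold. -/
abbrev Model (n : ℕ) : Type := EuclideanSpace ℝ (Fin (n + 1))

/-- A smooth Lorentzian metric, of signature `(-, +, …, +)`, on an `(n + 1)`-dimensional manifold:
a smooth field of symmetric bilinear forms, each of which is negative on some vector `v` and
positive definite on the orthogonal complement of `v`. -/
structure LorentzianMetric (n : ℕ) (M : Type*) [TopologicalSpace M]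
    [ChartedSpace (Model n) M] [IsManifold (𝓡 (n + 1)) ∞ M] where
  val (p : M) : TangentSpace (𝓡 (n + 1)) p →L[ℝ] TangentSpace (𝓡 (n + 1)) p →L[ℝ] ℝ
  symm (p : M) (v w : TangentSpace (𝓡 (n + 1)) p) : val p v w = val p w v
  signature (p : M) : ∃ v : TangentSpace (𝓡 (n + 1)) p, val p v v < 0 ∧
    ∀ w : TangentSpace (𝓡 (n + 1)) p, val p v w = 0 → w ≠ 0 → 0 < val p w w
  contMDiff : ContMDiff (𝓡 (n + 1))
    ((𝓡 (n + 1)).prod 𝓘(ℝ, Model n →L[ℝ] Model n →L[ℝ] ℝ)) ∞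
    (fun p : M ↦ TotalSpace.mk' (Model n →L[ℝ] Model n →L[ℝ] ℝ)
      (E := fun q : M ↦ TangentSpace (𝓡 (n + 1)) q →L[ℝ] TangentSpace (𝓡 (n + 1)) q →L[ℝ] ℝ)
      p (val p))

variable {n : ℕ} {M : Type*} [TopologicalSpace M]
  [ChartedSpace (Model n) M] [IsManifold (𝓡 (n + 1)) ∞ M]

/-- A time orientation, given by a smooth timelike vector field. -/
structure TimeOrientation (g : LorentzianMetric n M) where
  field (p : M) : TangentSpace (𝓡 (n + 1)) p
  timelike (p : M) : g.val p (field p) (field p) < 0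
  contMDiff : ContMDiff (𝓡 (n + 1)) (𝓡 (n + 1)).tangent ∞
    (fun p : M ↦ (⟨p, field p⟩ : TangentBundle (𝓡 (n + 1)) M))

/-- A vector is timelike if `g(v, v) < 0`. -/
def IsTimelike (g : LorentzianMetric n M) {p : M} (v : TangentSpace (𝓡 (n + 1)) p) : Prop :=
  g.val p v v < 0

/-- A vector is causal (non-spacelike) if it is nonzero and `g(v, v) ≤ 0`. -/
def IsCausal (g : LorentzianMetric n M) {p : M} (v : TangentSpace (𝓡 (n + 1)) p) : Prop :=
  v ≠ 0 ∧ g.val p v v ≤ 0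

/-- A causal vector is future directed if it lies in the same half of the causal cone as the
field `T` giving the time orientation, that is, if `g(v, T) < 0`. -/
def IsFutureDirected {g : LorentzianMetric n M} (T : TimeOrientation g) {p : M}
    (v : TangentSpace (𝓡 (n + 1)) p) : Prop :=
  g.val p v (T.field p) < 0

/-! ### Curves -/

/-- The velocity `γ'(t)` of a curve. -/
def velocity (n : ℕ) {M : Type*} [TopologicalSpace M] [ChartedSpace (Model n) M]
    (γ : ℝ → M) (t : ℝ) : TangentSpace (𝓡 (n + 1)) (γ t) :=
  mfderiv 𝓘(ℝ, ℝ) (𝓡 (n + 1)) γ t (1 : ℝ)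

/-- `γ`, restricted to `I`, is a `C¹` curve parametrized by a nonempty open interval. -/
structure IsCurveOn (n : ℕ) {M : Type*} [TopologicalSpace M] [ChartedSpace (Model n) M]
    (γ : ℝ → M) (I : Set ℝ) : Prop where
  isOpen : IsOpen I
  ordConnected : I.OrdConnected
  nonempty : I.Nonempty
  contMDiffOn : ContMDiffOn 𝓘(ℝ, ℝ) (𝓡 (n + 1)) 1 γ I

/-- A causal (non-spacelike) curve. -/
def IsCausalCurve (g : LorentzianMetric n M) (γ : ℝ → M) (I : Set ℝ) : Prop :=
  IsCurveOn n γ I ∧ ∀ t ∈ I, IsCausal g (velocity n γ t)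

/-- A future-directed timelike curve. -/
def IsFutureTimelikeCurve {g : LorentzianMetric n M} (T : TimeOrientation g)
    (γ : ℝ → M) (I : Set ℝ) : Prop :=
  IsCurveOn n γ I ∧
    ∀ t ∈ I, IsTimelike g (velocity n γ t) ∧ IsFutureDirected T (velocity n γ t)

/-- A curve parametrized by an open interval is inextendible if it has no endpoint in `M`, that is,
no limit as the parameter tends to the upper end or to the lower end of the interval. -/
def IsInextendible {M : Type*} [TopologicalSpace M] (γ : ℝ → M) (I : Set ℝ) : Prop :=
  (¬ ∃ p : M, Tendsto (fun t : I ↦ γ t) atTop (𝓝 p)) ∧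
    ¬ ∃ p : M, Tendsto (fun t : I ↦ γ t) atBot (𝓝 p)

/-! ### Hypersurfaces -/

/-- `S` is a smooth embedded hypersurface (without boundary): near each of its points it is the
zero set of a smooth function with nonvanishing differential. -/
def IsHypersurface (n : ℕ) {M : Type*} [TopologicalSpace M] [ChartedSpace (Model n) M]
    (S : Set M) : Prop :=
  ∀ p ∈ S, ∃ (U : Set M) (f : M → ℝ), IsOpen U ∧ p ∈ U ∧
    ContMDiffOn (𝓡 (n + 1)) 𝓘(ℝ, ℝ) ∞ f U ∧
    (∀ q ∈ U, q ∈ S ↔ f q = 0) ∧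
    ∀ q ∈ U, mfderiv (𝓡 (n + 1)) 𝓘(ℝ, ℝ) f q ≠ 0

/-- The vector `v` belongs to the tangent space `T_p S`: it is annihilated by the differential at
`p` of every function that is smooth at `p` and vanishes on `S` near `p`. -/
def IsTangentTo (S : Set M) {p : M} (v : TangentSpace (𝓡 (n + 1)) p) : Prop :=
  ∀ f : M → ℝ, ContMDiffAt (𝓡 (n + 1)) 𝓘(ℝ, ℝ) ∞ f p → (∀ᶠ q in 𝓝[S] p, f q = 0) →
    mfderiv (𝓡 (n + 1)) 𝓘(ℝ, ℝ) f p v = (0 : ℝ)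

/-- A spacelike hypersurface: the metric is positive definite on each of its tangent spaces. -/
def IsSpacelikeHypersurface (g : LorentzianMetric n M) (S : Set M) : Prop :=
  IsHypersurface n S ∧
    ∀ p ∈ S, ∀ v : TangentSpace (𝓡 (n + 1)) p, IsTangentTo S v → v ≠ 0 → 0 < g.val p v v

/-- A Cauchy surface: a spacelike hypersurface that every inextendible causal curve meets
exactly once. -/
def IsCauchySurface (g : LorentzianMetric n M) (S : Set M) : Prop :=
  IsSpacelikeHypersurface g S ∧
    ∀ (γ : ℝ → M) (I : Set ℝ), IsCausalCurve g γ I → IsInextendible γ I → ∃! t, t ∈ I ∧ γ t ∈ S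

/-! ### The Levi-Civita connection and the mean curvature -/

/-- The metric in the chart `φ` at `p`: the number `g(dφ⁻¹ u, dφ⁻¹ v)` at the point with
coordinates `x`. -/
def metricInChart (g : LorentzianMetric n M) (p : M) (x u v : Model n) : ℝ :=
  g.val ((extChartAt (𝓡 (n + 1)) p).symm x)
    (mfderiv 𝓘(ℝ, Model n) (𝓡 (n + 1)) (extChartAt (𝓡 (n + 1)) p).symm x u)
    (mfderiv 𝓘(ℝ, Model n) (𝓡 (n + 1)) (extChartAt (𝓡 (n + 1)) p).symm x v)

/-- The Christoffel symbols of the first kind at `p`, in the chart at `p`: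
`(∂_u g(v, w) + ∂_v g(u, w) - ∂_w g(u, v)) / 2`. -/
def christoffel (g : LorentzianMetric n M) (p : M) (u v w : Model n) : ℝ :=
  (fderiv ℝ (fun x ↦ metricInChart g p x v w) (extChartAt (𝓡 (n + 1)) p p) u
    + fderiv ℝ (fun x ↦ metricInChart g p x u w) (extChartAt (𝓡 (n + 1)) p p) v
    - fderiv ℝ (fun x ↦ metricInChart g p x u v) (extChartAt (𝓡 (n + 1)) p p) w) / 2

/-- The coordinates of a tangent vector at `q` in the chart at `p`. -/
def vectorInChart (p : M) {q : M} (v : TangentSpace (𝓡 (n + 1)) q) : Model n :=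
  mfderiv (𝓡 (n + 1)) 𝓘(ℝ, Model n) (extChartAt (𝓡 (n + 1)) p) q v

/-- The vector field `N` in the chart at `p`. -/
def fieldInChart (N : ∀ q : M, TangentSpace (𝓡 (n + 1)) q) (p : M) (x : Model n) : Model n :=
  vectorInChart p (N ((extChartAt (𝓡 (n + 1)) p).symm x))

/-- The number `g(∇_X N, Y)` at `p`, where `∇` is the Levi-Civita connection of `g`, computed in
the chart at `p`: with coordinates `u`, `w` of `X`, `Y` it is `g(∂_u N, w) + Γ(u, N, w)`. -/
def covDeriv (g : LorentzianMetric n M) (N : ∀ q : M, TangentSpace (𝓡 (n + 1)) q) (p : M)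
    (X Y : TangentSpace (𝓡 (n + 1)) p) : ℝ :=
  metricInChart g p (extChartAt (𝓡 (n + 1)) p p)
      (fderiv ℝ (fieldInChart N p) (extChartAt (𝓡 (n + 1)) p p) (vectorInChart p X))
      (vectorInChart p Y)
    + christoffel g p (vectorInChart p X) (vectorInChart p (N p)) (vectorInChart p Y)

/-- `N` is a smooth vector field on the open set `U` whose restriction to `S ∩ U` is the
future-pointing unit normal vector field of `S`. -/
structure IsFutureUnitNormalOn {g : LorentzianMetric n M} (T : TimeOrientation g) (S U : Set M)
    (N : ∀ q : M, TangentSpace (𝓡 (n + 1)) q) : Prop where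
  isOpen : IsOpen U
  contMDiffOn : ContMDiffOn (𝓡 (n + 1)) (𝓡 (n + 1)).tangent ∞
    (fun q : M ↦ (⟨q, N q⟩ : TangentBundle (𝓡 (n + 1)) M)) U
  unit : ∀ q ∈ S ∩ U, g.val q (N q) (N q) = -1
  future : ∀ q ∈ S ∩ U, IsFutureDirected T (N q)
  normal : ∀ q ∈ S ∩ U, ∀ v : TangentSpace (𝓡 (n + 1)) q, IsTangentTo S v → g.val q (N q) v = 0

/-- The second fundamental form `II(X, Y) = -g(∇_X N, Y)`, for `N` a local extension of the
future-pointing unit normal field; on tangent vectors of the hypersurface it does not depend on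
the extension. -/
def secondFundamentalForm (g : LorentzianMetric n M) (N : ∀ q : M, TangentSpace (𝓡 (n + 1)) q)
    (p : M) (X Y : TangentSpace (𝓡 (n + 1)) p) : ℝ :=
  -covDeriv g N p X Y

/-- The spacelike hypersurface `S` has mean curvature `H` at `p`: `H` is the trace of the second
fundamental form, that is `∑ i, II(e i, e i)` for an orthonormal basis `e` of `T_p S`. -/
def HasMeanCurvatureAt {g : LorentzianMetric n M} (T : TimeOrientation g) (S : Set M) (p : M)
    (H : ℝ) : Prop :=
  ∃ (U : Set M) (N : ∀ q : M, TangentSpace (𝓡 (n + 1)) q)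
    (e : Fin n → TangentSpace (𝓡 (n + 1)) p),
    p ∈ U ∧ IsFutureUnitNormalOn T S U N ∧
    (∀ i, IsTangentTo S (e i)) ∧
    (∀ i j, g.val p (e i) (e j) = if i = j then 1 else 0) ∧
    H = ∑ i, secondFundamentalForm g N p (e i) (e i)

/-- `S` is a spacelike hypersurface of constant mean curvature `c`. -/
def HasConstantMeanCurvature {g : LorentzianMetric n M} (T : TimeOrientation g) (S : Set M)
    (c : ℝ) : Prop :=
  IsSpacelikeHypersurface g S ∧ ∀ p ∈ S, HasMeanCurvatureAt T S p c

/-! ### Time functions -/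

/-- A time function: a smooth submersion to `ℝ` that is strictly increasing along every
future-directed timelike curve. -/
def IsTimeFunction {g : LorentzianMetric n M} (T : TimeOrientation g) (τ : M → ℝ) : Prop :=
  IsSubmersion (𝓡 (n + 1)) 𝓘(ℝ, ℝ) ∞ τ ∧
    ∀ (γ : ℝ → M) (I : Set ℝ), IsFutureTimelikeCurve T γ I → StrictMonoOn (τ ∘ γ) I

/-- A CMC time function: a time function whose fiber over each `θ` is a (possibly empty)
spacelike hypersurface of constant mean curvature `θ`. -/
def IsCMCTimeFunction {g : LorentzianMetric n M} (T : TimeOrientation g) (τ : M → ℝ) : Prop :=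
  IsTimeFunction T τ ∧ ∀ θ : ℝ, HasConstantMeanCurvature T (τ ⁻¹' {θ}) θ

end Spacetime

end

/-!
Let `Σ` have constant mean curvature `c`. At a point where `τ` attains its maximum `θ` on `Σ`, the
hypersurface `Σ` is tangent to the fiber `τ⁻¹(θ)` and lies on its past side, and comparing second
fundamental forms at that point gives `θ ≤ c`. In the same way the minimum of `τ` on `Σ` is at
least `c`, so `τ = c` on `Σ`.

Conversely, every point of `M` lies on an integral curve of the time orientation that meets `Σ`:
the union of these curves is open because they are transverse to `Σ`, and closed because it is the
preimage of a compact set under the projection of `M` to a Cauchy surface along the time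
orientation. As `τ` is strictly increasing along such a curve, the curve meets `τ⁻¹(c)` only once,
hence `τ⁻¹(c) ⊆ Σ`.
-/

namespace Spacetime

/-! ### Functions restricted to a level set -/

section LevelSets

variable {E : Type*} [NormedAddCommGroup E] [NormedSpace ℝ E]

theorem exists_eq_smul_of_forall_apply_eq_zero {f' ℓ : StrongDual ℝ E}
    (h : ∀ v, f' v = 0 → ℓ v = 0) : ∃ κ : ℝ, ℓ = κ • f' := by
  have hspan := mem_span_of_iInf_ker_le_ker (L := fun _ : Unit ↦ f'.toLinearMap)
    (K := ℓ.toLinearMap) (iInf_const.trans_le fun v hv ↦ h v hv)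
  rw [range_const, Submodule.mem_span_singleton] at hspan
  obtain ⟨κ, hκ⟩ := hspan
  exact ⟨κ, ContinuousLinearMap.coe_injective hκ.symm⟩

variable {f : E → ℝ} {x₀ X : E}

theorem exists_contDiffAt_curve_in_level {m : ℕ∞ω} (hf : ContDiffAt ℝ m f x₀) (hm : m ≠ 0)
    (hf' : fderiv ℝ f x₀ ≠ 0) (hX : fderiv ℝ f x₀ X = 0) :
    ∃ c : ℝ → E, ContDiffAt ℝ m c 0 ∧ c 0 = x₀ ∧ deriv c 0 = X ∧
      ∀ᶠ t in 𝓝 0, f (c t) = f x₀ := by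
  obtain ⟨w, hw⟩ := (fderiv ℝ f x₀).exists_ne_zero hf'
  let A : ℝ × ℝ →L[ℝ] E := .coprod (.toSpanSingleton ℝ X) (.toSpanSingleton ℝ w)
  have hA (z : ℝ × ℝ) : A z = z.1 • X + z.2 • w := rfl
  let G : ℝ × ℝ → ℝ := fun z ↦ f (x₀ + A z)
  have hG : ContDiffAt ℝ m G 0 :=
    ContDiffAt.comp 0 (by simpa using hf) (contDiffAt_const.add A.contDiff.contDiffAt)
  have hG' : fderiv ℝ G 0 = (fderiv ℝ f x₀).comp A := by
    have h : HasFDerivAt f (fderiv ℝ f x₀) (x₀ + A 0) := by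
      simpa using (hf.differentiableAt hm).hasFDerivAt
    exact (h.comp 0 (A.hasFDerivAt.const_add x₀)).fderiv
  have hinv : (fderiv ℝ G 0 ∘L .inr ℝ ℝ ℝ).IsInvertible := by
    refine ⟨.unitsEquivAut ℝ (Units.mk0 _ hw), ?_⟩
    ext; simp [hG', hA]
  set ψ := hG.implicitFunction hm hinv
  have hψ : ContDiffAt ℝ m ψ 0 := hG.contDiffAt_implicitFunction hm hinv
  have hψ0 : ψ 0 = 0 := hG.implicitFunction_apply_self hm hinv
  have hψ' : HasDerivAt ψ 0 0 := by
    have h := (hG.hasStrictFDerivAt_implicitFunction hm hinv).hasFDerivAt.hasDerivAt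
    simpa [hG', hA, hX] using! h
  refine ⟨fun t ↦ x₀ + A (t, ψ t), ?_, by simp [hψ0, hA], ?_, ?_⟩
  · exact contDiffAt_const.add (A.contDiff.contDiffAt.comp 0 (contDiffAt_id.prodMk hψ))
  · have h := (A.hasFDerivAt.comp_hasDerivAt (0 : ℝ) ((hasDerivAt_id 0).prodMk hψ')).const_add x₀
    simpa [hA] using! h.deriv
  · simpa [G, hA, ψ] using hG.eventually_apply_implicitFunction hm hinv

theorem fderiv_apply_eq_zero_of_eventually_level {F : Type*} [NormedAddCommGroup F]
    [NormedSpace ℝ F] {h : E → F} (hf : ContDiffAt ℝ 1 f x₀) (hf' : fderiv ℝ f x₀ ≠ 0)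
    (hh : DifferentiableAt ℝ h x₀) (hlevel : ∀ᶠ x in 𝓝 x₀, f x = f x₀ → h x = h x₀)
    (hX : fderiv ℝ f x₀ X = 0) : fderiv ℝ h x₀ X = 0 := by
  obtain ⟨c, hc, rfl, rfl, hfc⟩ := exists_contDiffAt_curve_in_level hf one_ne_zero hf' hX
  have hconst : h ∘ c =ᶠ[𝓝 0] fun _ ↦ h (c 0) := by
    filter_upwards [hfc, hc.continuousAt.eventually hlevel] with t ht h1 using h1 ht
  rw [← fderiv_comp_deriv 0 hh (hc.differentiableAt one_ne_zero), hconst.deriv_eq, deriv_const]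

theorem deriv_deriv_nonpos_of_isLocalMax {h : ℝ → ℝ} {a : ℝ} (hh : ContinuousAt h a)
    (hmax : IsLocalMax h a) : deriv (deriv h) a ≤ 0 := by
  by_contra! hpos
  have hmin := isLocalMin_of_deriv_deriv_pos hpos hmax.deriv_eq_zero hh
  have hconst : h =ᶠ[𝓝 a] fun _ ↦ h a := by
    filter_upwards [hmax, hmin] with t h1 h2 using le_antisymm h1 h2
  simp [hconst.deriv.deriv_eq] at hpos

theorem deriv_deriv_comp {h : E → ℝ} {c : ℝ → E} {t₀ : ℝ} (hh : ContDiffAt ℝ 2 h (c t₀))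
    (hc : ContDiffAt ℝ 2 c t₀) :
    deriv (deriv (h ∘ c)) t₀ =
      fderiv ℝ (fderiv ℝ h) (c t₀) (deriv c t₀) (deriv c t₀) +
        fderiv ℝ h (c t₀) (deriv (deriv c) t₀) := by
  have hderiv : deriv (h ∘ c) =ᶠ[𝓝 t₀] fun t ↦ fderiv ℝ h (c t) (deriv c t) := by
    filter_upwards [hc.eventually (by simp), hc.continuousAt.eventually (hh.eventually (by simp))]
      with t h1 h2
    exact fderiv_comp_deriv t (h2.differentiableAt two_ne_zero) (h1.differentiableAt two_ne_zero)
  have hDh : HasFDerivAt (fderiv ℝ h) _ (c t₀) :=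
    ((hh.fderiv_right (m := 1) le_rfl).differentiableAt one_ne_zero).hasFDerivAt
  have hc' : HasDerivAt c _ t₀ := (hc.differentiableAt two_ne_zero).hasDerivAt
  have hc'' : DifferentiableAt ℝ (deriv c) t₀ :=
    ((hc.fderiv_right (m := 1) le_rfl).differentiableAt one_ne_zero).clm_apply
      (differentiableAt_const (1 : ℝ))
  rw [hderiv.deriv_eq]
  exact ((hDh.comp_hasDerivAt t₀ hc').clm_apply hc''.hasDerivAt).deriv

theorem snd_fderiv_apply_le_of_isLocalMaxOn_level {k : E → ℝ} {κ : ℝ} (hf : ContDiffAt ℝ 2 f x₀)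
    (hf' : fderiv ℝ f x₀ ≠ 0) (hk : ContDiffAt ℝ 2 k x₀)
    (hmax : IsLocalMaxOn k {x | f x = f x₀} x₀) (hκ : fderiv ℝ k x₀ = κ • fderiv ℝ f x₀)
    (hX : fderiv ℝ f x₀ X = 0) :
    fderiv ℝ (fderiv ℝ k) x₀ X X ≤ κ * fderiv ℝ (fderiv ℝ f) x₀ X X := by
  obtain ⟨c, hc, rfl, rfl, hfc⟩ := exists_contDiffAt_curve_in_level hf two_ne_zero hf' hX
  have hkc : deriv (deriv (k ∘ c)) 0 ≤ 0 := by
    refine deriv_deriv_nonpos_of_isLocalMax (hk.continuousAt.comp hc.continuousAt) ?_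
    filter_upwards [hfc, hc.continuousAt.eventually (eventually_nhdsWithin_iff.1 hmax)]
      with t h1 h2 using h2 h1
  have hfc0 : deriv (deriv (f ∘ c)) 0 = 0 := by
    have hconst : f ∘ c =ᶠ[𝓝 0] fun _ ↦ f (c 0) := hfc
    simp [hconst.deriv.deriv_eq]
  rw [deriv_deriv_comp hk hc, hκ] at hkc
  rw [deriv_deriv_comp hf hc] at hfc0
  simp only [smul_apply, smul_eq_mul] at hkc
  linear_combination hkc - κ * hfc0

theorem fderiv_eq_smul_of_isLocalExtrOn_level {k : E → ℝ} (hf : ContDiffAt ℝ 1 f x₀)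
    (hf' : fderiv ℝ f x₀ ≠ 0) (hk : DifferentiableAt ℝ k x₀)
    (hextr : IsLocalExtrOn k {x | f x = f x₀} x₀) :
    ∃ κ : ℝ, fderiv ℝ k x₀ = κ • fderiv ℝ f x₀ := by
  refine exists_eq_smul_of_forall_apply_eq_zero fun v hv ↦ ?_
  obtain ⟨c, hc, rfl, rfl, hfc⟩ := exists_contDiffAt_curve_in_level hf one_ne_zero hf' hv
  have hlevel : Tendsto c (𝓝 0) (𝓝[{x | f x = f (c 0)}] c 0) :=
    tendsto_nhdsWithin_iff.2 ⟨hc.continuousAt, hfc⟩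
  rw [← fderiv_comp_deriv 0 hk (hc.differentiableAt one_ne_zero)]
  exact IsLocalExtr.deriv_eq_zero (hextr.comp_tendsto hlevel)

theorem fderiv_apply_of_eventually_conormal {η : E → StrongDual ℝ E} {a : ℝ}
    (hf : ContDiffAt ℝ 2 f x₀) (hf' : fderiv ℝ f x₀ ≠ 0) (hη : DifferentiableAt ℝ η x₀)
    (hconormal : ∀ᶠ x in 𝓝 x₀, f x = f x₀ → ∀ v, fderiv ℝ f x v = 0 → η x v = 0)
    (ha : η x₀ = a • fderiv ℝ f x₀) (hX : fderiv ℝ f x₀ X = 0) :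
    fderiv ℝ η x₀ X X = a * fderiv ℝ (fderiv ℝ f) x₀ X X := by
  obtain ⟨w, hw⟩ := (fderiv ℝ f x₀).exists_ne_zero hf'
  have hdf : HasFDerivAt (fderiv ℝ f) _ x₀ :=
    ((hf.fderiv_right (m := 1) le_rfl).differentiableAt one_ne_zero).hasFDerivAt
  have hη' := hη.hasFDerivAt
  let h : E → ℝ := fun x ↦ η x (fderiv ℝ f x w • X - fderiv ℝ f x X • w)
  have hh : HasFDerivAt h _ x₀ := hη'.clm_apply
    (((hdf.clm_apply (hasFDerivAt_const w x₀)).smul_const X).sub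
      ((hdf.clm_apply (hasFDerivAt_const X x₀)).smul_const w))
  have hzero {x} (hx : ∀ v, fderiv ℝ f x v = 0 → η x v = 0) : h x = 0 :=
    hx _ (by simp [mul_comm])
  have hh0 : fderiv ℝ h x₀ X = 0 := by
    refine fderiv_apply_eq_zero_of_eventually_level (hf.of_le one_le_two) hf'
      hh.differentiableAt ?_ hX
    filter_upwards [hconormal] with x hx hfx
    rw [hzero (hx hfx), hzero (hconormal.self_of_nhds rfl)]
  have hhX : fderiv ℝ h x₀ X = -(a * (fderiv ℝ (fderiv ℝ f) x₀ X X * fderiv ℝ f x₀ w)) +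
      fderiv ℝ f x₀ w * fderiv ℝ η x₀ X X := by
    simp [hh.fderiv, hX, ha]
  apply mul_right_cancel₀ hw
  linear_combination hh0 - hhX

end LevelSets

/-! ### The metric in a chart -/

section Trace

theorem sum_apply_self_eq_of_orthonormal {R V ι : Type*} [CommRing R] [AddCommGroup V]
    [Module R V] [Fintype ι] [DecidableEq ι] (G B : V →ₗ[R] V →ₗ[R] R) {e e' : ι → V}
    (he : ∀ i j, G (e i) (e j) = if i = j then 1 else 0)
    (he' : ∀ i j, G (e' i) (e' j) = if i = j then 1 else 0)
    (hspan : ∀ j, e' j ∈ Submodule.span R (range e)) :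
    ∑ i, B (e i) (e i) = ∑ i, B (e' i) (e' i) := by
  choose c hc using fun j ↦ (Submodule.mem_span_range_iff_exists_fun R).1 (hspan j)
  let C : Matrix ι ι R := .of c
  have hgram (B : V →ₗ[R] V →ₗ[R] R) :
      Matrix.of (fun j k ↦ B (e' j) (e' k)) =
        C * Matrix.of (fun i l ↦ B (e i) (e l)) * C.transpose := by
    ext j k
    simp only [← hc, map_sum, map_smul, LinearMap.sum_apply, LinearMap.smul_apply, smul_eq_mul,
      Matrix.mul_apply, Matrix.transpose_apply, Matrix.of_apply, Finset.sum_mul,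
      Finset.mul_sum, C]
    exact Finset.sum_congr rfl fun l _ ↦ Finset.sum_congr rfl fun i _ ↦ by ring
  have hC : C.transpose * C = 1 := mul_eq_one_comm.1 <| by
    have hone : Matrix.of (fun i j : ι ↦ if i = j then (1 : R) else 0) = 1 := by
      ext i j; simp [Matrix.one_apply]
    simpa only [he, he', hone, mul_one] using (hgram G).symm
  change (Matrix.of fun i l ↦ B (e i) (e l)).trace = (Matrix.of fun j k ↦ B (e' j) (e' k)).trace
  rw [hgram, Matrix.trace_mul_comm, ← mul_assoc, hC, one_mul]

theorem linearIndependent_of_orthonormal {R V ι : Type*} [CommRing R] [AddCommGroup V]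
    [Module R V] [DecidableEq ι] (G : V →ₗ[R] V →ₗ[R] R) {e : ι → V}
    (he : ∀ i j, G (e i) (e j) = if i = j then 1 else 0) : LinearIndependent R e := by
  refine linearIndependent_iff'.2 fun s c hc j hj ↦ ?_
  simpa [he, hj] using congrArg (fun v ↦ G v (e j)) hc

theorem span_range_eq_ker {K V ι : Type*} [Field K] [AddCommGroup V] [Module K V]
    [FiniteDimensional K V] [Fintype ι] (hι : Module.finrank K V = Fintype.card ι + 1)
    {ℓ : Module.Dual K V} (hℓ : ℓ ≠ 0) {e : ι → V} (he : LinearIndependent K e)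
    (heℓ : ∀ i, ℓ (e i) = 0) : Submodule.span K (range e) = LinearMap.ker ℓ := by
  refine Submodule.eq_of_le_of_finrank_eq (Submodule.span_le.2 (range_subset_iff.2 heℓ)) ?_
  have hker := Module.Dual.finrank_ker_add_one_of_ne_zero hℓ
  rw [finrank_span_eq_card he]
  lia

theorem sum_apply_self_eq_of_mem_ker {K V ι : Type*} [Field K] [AddCommGroup V] [Module K V]
    [FiniteDimensional K V] [Fintype ι] [DecidableEq ι]
    (hι : Module.finrank K V = Fintype.card ι + 1) {ℓ : Module.Dual K V} (hℓ : ℓ ≠ 0)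
    {G : V →ₗ[K] V →ₗ[K] K} (B : V →ₗ[K] V →ₗ[K] K) {e e' : ι → V}
    (he : ∀ i, ℓ (e i) = 0) (he' : ∀ i, ℓ (e' i) = 0)
    (horth : ∀ i j, G (e i) (e j) = if i = j then 1 else 0)
    (horth' : ∀ i j, G (e' i) (e' j) = if i = j then 1 else 0) :
    ∑ i, B (e i) (e i) = ∑ i, B (e' i) (e' i) := by
  have hspan := span_range_eq_ker hι hℓ (linearIndependent_of_orthonormal G horth) he
  exact sum_apply_self_eq_of_orthonormal G B horth horth' fun j ↦ hspan ▸ he' j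

end Trace

section Charts

variable {n : ℕ} {M : Type*} [TopologicalSpace M] [ChartedSpace (Model n) M]

local notation "φ[" p "]" => extChartAt (𝓡 (n + 1)) p

theorem tendsto_chart_symm (p : M) : Tendsto φ[p].symm (𝓝 (φ[p] p)) (𝓝 p) := by
  simpa only [ContinuousAt, extChartAt_to_inv] using continuousAt_extChartAt_symm (I := 𝓡 (n + 1)) p

theorem chart_target_mem_nhds (p : M) : φ[p].target ∈ 𝓝 (φ[p] p) :=
  (isOpen_extChartAt_target p).mem_nhds (mem_extChartAt_target p)

theorem contDiffAt_comp_chart_symm {F : Type*} [NormedAddCommGroup F] [NormedSpace ℝ F]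
    {m : ℕ∞ω} {f : M → F} {p : M} (hf : ContMDiffAt (𝓡 (n + 1)) 𝓘(ℝ, F) m f p) :
    ContDiffAt ℝ m (f ∘ φ[p].symm) (φ[p] p) := by
  simpa using! (contMDiffAt_iff.1 hf).2

theorem fderiv_comp_chart_symm_self {f : M → ℝ} {p : M}
    (hf : MDifferentiableAt (𝓡 (n + 1)) 𝓘(ℝ, ℝ) f p) :
    fderiv ℝ (f ∘ φ[p].symm) (φ[p] p) = (mfderiv (𝓡 (n + 1)) 𝓘(ℝ, ℝ) f p : Model n →L[ℝ] ℝ) := by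
  refine Eq.trans ?_ hf.mfderiv.symm
  simp only [writtenInExtChartAt, Function.comp_def, ModelWithCorners.range_eq_univ,
    fderivWithin_univ, extChartAt_model_space_eq_id, PartialEquiv.refl_coe, id]

variable [IsManifold (𝓡 (n + 1)) ∞ M]

theorem mdifferentiableAt_chart_symm {p : M} {x : Model n} (hx : x ∈ φ[p].target) :
    MDifferentiableAt 𝓘(ℝ, Model n) (𝓡 (n + 1)) φ[p].symm x := by
  rw [← mdifferentiableWithinAt_univ, ← ModelWithCorners.range_eq_univ (𝓡 (n + 1))]
  exact mdifferentiableWithinAt_extChartAt_symm hx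

theorem mfderiv_chart_symm_vectorInChart {p : M} {x : Model n} (hx : x ∈ φ[p].target)
    (v : TangentSpace (𝓡 (n + 1)) (φ[p].symm x)) :
    mfderiv 𝓘(ℝ, Model n) (𝓡 (n + 1)) φ[p].symm x (vectorInChart p v) = v := by
  have h := mfderivWithin_extChartAt_symm_comp_mfderiv_extChartAt hx
  rw [ModelWithCorners.range_eq_univ, mfderivWithin_univ] at h
  exact DFunLike.congr_fun h v

theorem fderiv_comp_chart_symm {f : M → ℝ} {p : M} {x : Model n} (hx : x ∈ φ[p].target)
    (hf : MDifferentiableAt (𝓡 (n + 1)) 𝓘(ℝ, ℝ) f (φ[p].symm x)) (u : Model n) :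
    fderiv ℝ (f ∘ φ[p].symm) x u =
      mfderiv (𝓡 (n + 1)) 𝓘(ℝ, ℝ) f (φ[p].symm x)
        (mfderiv 𝓘(ℝ, Model n) (𝓡 (n + 1)) φ[p].symm x u) := by
  rw [← mfderiv_eq_fderiv, mfderiv_comp x hf (mdifferentiableAt_chart_symm hx)]
  rfl

theorem vectorInChart_self {p : M} (v : TangentSpace (𝓡 (n + 1)) p) : vectorInChart p v = v :=
  DFunLike.congr_fun (mfderiv_extChartAt_self (I := 𝓡 (n + 1)) (x := p)) v

theorem fieldInChart_self (N : ∀ q : M, TangentSpace (𝓡 (n + 1)) q) (p : M) :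
    fieldInChart N p (φ[p] p) = N p := by
  rw [fieldInChart, extChartAt_to_inv, vectorInChart_self]

theorem contDiffAt_fieldInChart {N : ∀ q : M, TangentSpace (𝓡 (n + 1)) q} {p : M}
    (hN : ContMDiffAt (𝓡 (n + 1)) (𝓡 (n + 1)).tangent ∞
      (fun q : M ↦ (⟨q, N q⟩ : TangentBundle (𝓡 (n + 1)) M)) p) :
    ContDiffAt ℝ ∞ (fieldInChart N p) (φ[p] p) := by
  have h := (contMDiffAt_section (IB := 𝓡 (n + 1)) (F := Model n)
    (E := TangentSpace (𝓡 (n + 1)) (M := M)) p).1 hN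
  refine (contDiffAt_comp_chart_symm h).congr_of_eventuallyEq ?_
  filter_upwards [chart_target_mem_nhds p] with x hx
  have hq : φ[p].symm x ∈ (chartAt (Model n) p).source := by simpa using φ[p].map_target hx
  have hs := TangentBundle.continuousLinearMapAt_trivializationAt (I := 𝓡 (n + 1)) hq
  refine (DFunLike.congr_fun hs (N _)).symm.trans ?_
  exact congrFun (Trivialization.coe_linearMapAt_of_mem (R := ℝ)
    (trivializationAt (Model n) (TangentSpace (𝓡 (n + 1)) (M := M)) p) hq) _

/-- The metric in the chart at `p`, as a field of continuous bilinear forms. -/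
noncomputable def chartMetric (g : LorentzianMetric n M) (p : M) (x : Model n) :
    Model n →L[ℝ] Model n →L[ℝ] ℝ :=
  let A : Model n →L[ℝ] Model n := mfderiv 𝓘(ℝ, Model n) (𝓡 (n + 1)) φ[p].symm x
  let B : Model n →L[ℝ] Model n →L[ℝ] ℝ := g.val (φ[p].symm x)
  B.bilinearComp A A

theorem chartMetric_apply (g : LorentzianMetric n M) (p : M) (x u v : Model n) :
    chartMetric g p x u v = metricInChart g p x u v := rfl

theorem chartMetric_comm (g : LorentzianMetric n M) (p : M) (x u v : Model n) :
    chartMetric g p x u v = chartMetric g p x v u :=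
  g.symm _ _ _

theorem chartMetric_self (g : LorentzianMetric n M) (p : M) :
    chartMetric g p (φ[p] p) = (g.val p : Model n →L[ℝ] Model n →L[ℝ] ℝ) := by
  have hsymm := mfderivWithin_range_extChartAt_symm (I := 𝓡 (n + 1)) (x := p)
  rw [ModelWithCorners.range_eq_univ, mfderivWithin_univ] at hsymm
  ext v w
  have h : ∀ q, q = p → ∀ A : Model n →L[ℝ] TangentSpace (𝓡 (n + 1)) q,
      (∀ u : Model n, A u = u) → g.val q (A v) (A w) = g.val p v w := by
    rintro q rfl A hA
    rw [hA v, hA w]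
  exact h _ (extChartAt_to_inv p) _ fun u ↦ DFunLike.congr_fun hsymm u

theorem contDiffAt_chartMetric (g : LorentzianMetric n M) (p : M) :
    ContDiffAt ℝ ∞ (chartMetric g p) (φ[p] p) := by
  have h := ((contMDiffAt_hom_bundle _).1 (g.contMDiff p)).2
  refine (contDiffAt_comp_chart_symm h).congr_of_eventuallyEq ?_
  filter_upwards [chart_target_mem_nhds p] with x hx
  have hq : φ[p].symm x ∈ (chartAt (Model n) p).source := by simpa using φ[p].map_target hx
  have hsymmL := TangentBundle.symmL_trivializationAt (I := 𝓡 (n + 1)) hq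
  rw [ModelWithCorners.range_eq_univ, mfderivWithin_univ, φ[p].right_inv hx] at hsymmL
  have hsymm (u : Model n) :
      (trivializationAt (Model n) (TangentSpace (𝓡 (n + 1)) (M := M)) p).symm (φ[p].symm x) u =
        mfderiv 𝓘(ℝ, Model n) (𝓡 (n + 1)) φ[p].symm x u :=
    (Trivialization.symmL_apply (R := ℝ) _ hq u).symm.trans (DFunLike.congr_fun hsymmL u)
  ext u v
  rw [Function.comp_apply, inCoordinates_apply_eq₂ hq hq (mem_univ _), hsymm, hsymm,
    Trivialization.coe_linearMapAt_of_mem _ (mem_univ _)]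
  rfl

end Charts

/-! ### Hypersurfaces and their second fundamental forms -/

theorem fderiv_apply_apply {E : Type*} [NormedAddCommGroup E] [NormedSpace ℝ E]
    {G : E → E →L[ℝ] E →L[ℝ] ℝ} {x₀ : E} (hG : DifferentiableAt ℝ G x₀) (u v w : E) :
    fderiv ℝ (fun x ↦ G x v w) x₀ u = fderiv ℝ G x₀ u v w := by
  have h := (hG.hasFDerivAt.clm_apply (hasFDerivAt_const v x₀)).clm_apply (hasFDerivAt_const w x₀)
  simp [h.fderiv]

section Hypersurfaces

variable {n : ℕ} {M : Type*} [TopologicalSpace M] [ChartedSpace (Model n) M]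

local notation "φ[" p "]" => extChartAt (𝓡 (n + 1)) p

/-- `f` is a smooth function with nonvanishing differential near `p`, whose zero set near `p`
is `S`. -/
structure IsDefiningFunctionAt (S : Set M) (p : M) (f : M → ℝ) : Prop where
  contMDiffAt : ContMDiffAt (𝓡 (n + 1)) 𝓘(ℝ, ℝ) ∞ f p
  mem_iff : ∀ᶠ q in 𝓝 p, q ∈ S ↔ f q = 0
  mfderiv_ne_zero : mfderiv (𝓡 (n + 1)) 𝓘(ℝ, ℝ) f p ≠ 0

variable {S : Set M} {p : M} {f k : M → ℝ}

theorem IsHypersurface.exists_eventually_isDefiningFunctionAt (hS : IsHypersurface n S)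
    (hp : p ∈ S) : ∃ f : M → ℝ, ∀ᶠ q in 𝓝 p, IsDefiningFunctionAt (n := n) S q f := by
  obtain ⟨U, f, hU, hpU, hf, hmem, hne⟩ := hS p hp
  refine ⟨f, ?_⟩
  filter_upwards [hU.mem_nhds hpU] with q hq
  have hUq := hU.mem_nhds hq
  exact ⟨hf.contMDiffAt hUq, eventually_of_mem hUq hmem, hne q hq⟩

namespace IsDefiningFunctionAt

theorem apply_eq_zero (hf : IsDefiningFunctionAt (n := n) S p f) (hp : p ∈ S) : f p = 0 :=
  hf.mem_iff.self_of_nhds.1 hp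

theorem mdifferentiableAt (hf : IsDefiningFunctionAt (n := n) S p f) :
    MDifferentiableAt (𝓡 (n + 1)) 𝓘(ℝ, ℝ) f p :=
  hf.contMDiffAt.mdifferentiableAt (by simp)

theorem contDiffAt (hf : IsDefiningFunctionAt (n := n) S p f) {m : ℕ} :
    ContDiffAt ℝ m (f ∘ φ[p].symm) (φ[p] p) :=
  contDiffAt_comp_chart_symm (hf.contMDiffAt.of_le (mod_cast le_top))

theorem fderiv_ne_zero (hf : IsDefiningFunctionAt (n := n) S p f) :
    fderiv ℝ (f ∘ φ[p].symm) (φ[p] p) ≠ 0 :=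
  fderiv_comp_chart_symm_self hf.mdifferentiableAt ▸ hf.mfderiv_ne_zero

theorem eventually_mem_iff_level (hf : IsDefiningFunctionAt (n := n) S p f) (hp : p ∈ S) :
    ∀ᶠ x in 𝓝 (φ[p] p), φ[p].symm x ∈ S ↔
      (f ∘ φ[p].symm) x = (f ∘ φ[p].symm) (φ[p] p) := by
  simpa only [Function.comp_apply, extChartAt_to_inv, hf.apply_eq_zero hp] using
    (tendsto_chart_symm p).eventually hf.mem_iff

theorem isTangentTo_iff_mfderiv (hf : IsDefiningFunctionAt (n := n) S p f) (hp : p ∈ S)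
    {v : TangentSpace (𝓡 (n + 1)) p} :
    IsTangentTo S v ↔ mfderiv (𝓡 (n + 1)) 𝓘(ℝ, ℝ) f p v = (0 : ℝ) := by
  refine ⟨fun hv ↦ hv f hf.contMDiffAt ?_, fun hv h hh hS ↦ ?_⟩
  · refine eventually_nhdsWithin_iff.2 ?_
    filter_upwards [hf.mem_iff] with q hq using hq.1
  have hlevel : ∀ᶠ x in 𝓝 (φ[p] p), (f ∘ φ[p].symm) x = (f ∘ φ[p].symm) (φ[p] p) →
      (h ∘ φ[p].symm) x = (h ∘ φ[p].symm) (φ[p] p) := by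
    have hS := eventually_nhdsWithin_iff.1 hS
    filter_upwards [hf.eventually_mem_iff_level hp, (tendsto_chart_symm p).eventually hS]
      with x h1 h2 h3
    simp only [Function.comp_apply, extChartAt_to_inv, h2 (h1.2 h3), hS.self_of_nhds hp]
  have hv0 (w : Model n) (hw : fderiv ℝ (f ∘ φ[p].symm) (φ[p] p) w = 0) :
      fderiv ℝ (h ∘ φ[p].symm) (φ[p] p) w = 0 :=
    fderiv_apply_eq_zero_of_eventually_level hf.contDiffAt hf.fderiv_ne_zero
      ((contDiffAt_comp_chart_symm hh).differentiableAt (by simp)) hlevel hw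
  rw [fderiv_comp_chart_symm_self hf.mdifferentiableAt,
    fderiv_comp_chart_symm_self (hh.mdifferentiableAt (by simp))] at hv0
  exact hv0 v hv

theorem isTangentTo_iff (hf : IsDefiningFunctionAt (n := n) S p f) (hp : p ∈ S) {v : Model n} :
    IsTangentTo S (p := p) v ↔ fderiv ℝ (f ∘ φ[p].symm) (φ[p] p) v = 0 := by
  rw [fderiv_comp_chart_symm_self hf.mdifferentiableAt]
  exact hf.isTangentTo_iff_mfderiv hp

theorem isLocalMaxOn_level (hf : IsDefiningFunctionAt (n := n) S p f) (hp : p ∈ S)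
    (hmax : IsLocalMaxOn k S p) :
    IsLocalMaxOn (k ∘ φ[p].symm) {x | (f ∘ φ[p].symm) x = (f ∘ φ[p].symm) (φ[p] p)} (φ[p] p) := by
  refine eventually_nhdsWithin_iff.2 ?_
  filter_upwards [hf.eventually_mem_iff_level hp,
    (tendsto_chart_symm p).eventually (eventually_nhdsWithin_iff.1 hmax)] with x h1 h2 h3
  simpa only [Function.comp_apply, extChartAt_to_inv] using h2 (h1.2 h3)

end IsDefiningFunctionAt

end Hypersurfaces

section SecondFundamentalForm

variable {n : ℕ} {M : Type*} [TopologicalSpace M] [ChartedSpace (Model n) M]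
  [IsManifold (𝓡 (n + 1)) ∞ M]

local notation "φ[" p "]" => extChartAt (𝓡 (n + 1)) p

theorem differentiableAt_chartMetric (g : LorentzianMetric n M) (p : M) :
    DifferentiableAt ℝ (chartMetric g p) (φ[p] p) :=
  (contDiffAt_chartMetric g p).differentiableAt (by simp)

theorem fderiv_metricInChart (g : LorentzianMetric n M) (p : M) (u v w : Model n) :
    fderiv ℝ (fun x ↦ metricInChart g p x v w) (φ[p] p) u =
      fderiv ℝ (chartMetric g p) (φ[p] p) u v w :=
  fderiv_apply_apply (differentiableAt_chartMetric g p) u v w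

theorem fderiv_chartMetric_comm (g : LorentzianMetric n M) (p : M) (u v w : Model n) :
    fderiv ℝ (chartMetric g p) (φ[p] p) u v w = fderiv ℝ (chartMetric g p) (φ[p] p) u w v := by
  simp only [← fderiv_metricInChart, ← chartMetric_apply, chartMetric_comm g p _ v w]

/-- A bilinear form with the same quadratic form `X ↦ g(∇_X N, X)` as `covDeriv g N p`: the
antisymmetric part of the Christoffel symbols is left out. -/
noncomputable def covDerivForm (g : LorentzianMetric n M)
    (N : ∀ q : M, TangentSpace (𝓡 (n + 1)) q) (p : M) : Model n →L[ℝ] Model n →L[ℝ] ℝ :=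
  (chartMetric g p (φ[p] p)).comp (fderiv ℝ (fieldInChart N p) (φ[p] p)) +
    (1 / 2 : ℝ) • fderiv ℝ (chartMetric g p) (φ[p] p) (fieldInChart N p (φ[p] p))

theorem covDerivForm_apply (g : LorentzianMetric n M) (N : ∀ q : M, TangentSpace (𝓡 (n + 1)) q)
    (p : M) (X Y : Model n) : covDerivForm g N p X Y =
      chartMetric g p (φ[p] p) (fderiv ℝ (fieldInChart N p) (φ[p] p) X) Y +
        1 / 2 * fderiv ℝ (chartMetric g p) (φ[p] p) (fieldInChart N p (φ[p] p)) X Y :=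
  rfl

theorem covDeriv_self (g : LorentzianMetric n M) (N : ∀ q : M, TangentSpace (𝓡 (n + 1)) q) (p : M)
    (X : Model n) : covDeriv g N p X X = covDerivForm g N p X X := by
  have hX : vectorInChart p (q := p) X = X := vectorInChart_self (p := p) X
  have hN : vectorInChart p (N p) = fieldInChart N p (φ[p] p) := by
    rw [fieldInChart, extChartAt_to_inv]
  unfold covDeriv christoffel
  rw [hX, hN, fderiv_metricInChart, fderiv_metricInChart,
    fderiv_metricInChart, fderiv_chartMetric_comm g p X X, covDerivForm_apply, chartMetric_apply]
  ring

end SecondFundamentalForm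

/-! ### Comparison of mean curvatures of tangent hypersurfaces -/

section Comparison

theorem unit_normal_unique {V : Type*} [AddCommGroup V] [Module ℝ V] {G : V →ₗ[ℝ] V →ₗ[ℝ] ℝ}
    {ℓ : V →ₗ[ℝ] ℝ} (hpos : ∀ v, ℓ v = 0 → v ≠ 0 → 0 < G v v) {N N' t : V} (hN : G N N = -1)
    (hN' : G N' N' = -1) (hperp : ∀ v, ℓ v = 0 → G N v = 0) (hperp' : ∀ v, ℓ v = 0 → G N' v = 0)
    (ht : G N t < 0) (ht' : G N' t < 0) : N = N' := by
  have hℓ : ℓ N' ≠ 0 := by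
    intro h
    have hN'0 : N' ≠ 0 := by rintro rfl; simp at hN'
    linarith [hpos N' h hN'0]
  obtain ⟨r, rfl⟩ : ∃ r : ℝ, N = r • N' := by
    refine ⟨ℓ N / ℓ N', sub_eq_zero.1 ?_⟩
    have hker : ℓ (N - (ℓ N / ℓ N') • N') = 0 := by simp [hℓ]
    by_contra hne
    have h := hpos _ hker hne
    simp [hperp _ hker, hperp' _ hker] at h
  simp only [map_smul, LinearMap.smul_apply, smul_eq_mul, hN'] at hN ht
  have hr1 : r = 1 := by nlinarith [pos_of_mul_neg_left ht ht'.le]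
  rw [hr1, one_smul]

variable {n : ℕ} {M : Type*} [TopologicalSpace M] [ChartedSpace (Model n) M]
  [IsManifold (𝓡 (n + 1)) ∞ M] {g : LorentzianMetric n M} {T : TimeOrientation g}
  {S F U U' : Set M} {N N' : ∀ q : M, TangentSpace (𝓡 (n + 1)) q} {p : M} {f k : M → ℝ} {κ : ℝ}

local notation "φ[" p "]" => extChartAt (𝓡 (n + 1)) p

theorem IsFutureUnitNormalOn.eq_of_isTangentTo_iff (hN : IsFutureUnitNormalOn T S U N)
    (hN' : IsFutureUnitNormalOn T F U' N') (hS : IsSpacelikeHypersurface g S) (hp : p ∈ S ∩ U)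
    (hp' : p ∈ F ∩ U')
    (htan : ∀ v : TangentSpace (𝓡 (n + 1)) p, IsTangentTo S v ↔ IsTangentTo F v) :
    N p = N' p := by
  obtain ⟨f, hf⟩ := hS.1.exists_eventually_isDefiningFunctionAt hp.1
  have hSf {v : Model n} := hf.self_of_nhds.isTangentTo_iff hp.1 (v := v)
  let G : Model n →L[ℝ] Model n →L[ℝ] ℝ := g.val p
  exact unit_normal_unique (V := Model n) (G := G.toBilinForm)
    (ℓ := (fderiv ℝ (f ∘ φ[p].symm) (φ[p] p)).toLinearMap) (t := T.field p)
    (fun v hv ↦ hS.2 p hp.1 v (hSf.2 hv)) (hN.unit p hp) (hN'.unit p hp')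
    (fun v hv ↦ hN.normal p hp v (hSf.2 hv))
    (fun v hv ↦ hN'.normal p hp' v ((htan v).1 (hSf.2 hv)))
    (hN.future p hp) (hN'.future p hp')

theorem IsFutureUnitNormalOn.eventually_conormal (hN : IsFutureUnitNormalOn T S U N)
    (hp : p ∈ S ∩ U) (hf : ∀ᶠ q in 𝓝 p, IsDefiningFunctionAt (n := n) S q f) :
    ∀ᶠ x in 𝓝 (φ[p] p), (f ∘ φ[p].symm) x = (f ∘ φ[p].symm) (φ[p] p) →
      ∀ v, fderiv ℝ (f ∘ φ[p].symm) x v = 0 → chartMetric g p x (fieldInChart N p x) v = 0 := by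
  filter_upwards [chart_target_mem_nhds p, (tendsto_chart_symm p).eventually hf,
    (tendsto_chart_symm p).eventually (hN.isOpen.mem_nhds hp.2),
    hf.self_of_nhds.eventually_mem_iff_level hp.1] with x hx hfx hxU hxS hlevel v hv
  have hq := hxS.2 hlevel
  rw [fderiv_comp_chart_symm hx hfx.mdifferentiableAt] at hv
  have hperp := hN.normal _ ⟨hq, hxU⟩ _ ((hfx.isTangentTo_iff_mfderiv hq).2 hv)
  rwa [← mfderiv_chart_symm_vectorInChart hx (N _)] at hperp

/-- The Hessian at `p` of the function `f`, written in the chart at `p`. -/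
noncomputable def chartHessian (f : M → ℝ) (p : M) : Model n →L[ℝ] Model n →L[ℝ] ℝ :=
  fderiv ℝ (fderiv ℝ (f ∘ φ[p].symm)) (φ[p] p)

theorem IsFutureUnitNormalOn.covDerivForm_self (hN : IsFutureUnitNormalOn T S U N)
    (hp : p ∈ S ∩ U) (hf : ∀ᶠ q in 𝓝 p, IsDefiningFunctionAt (n := n) S q f) {a : ℝ}
    (ha : chartMetric g p (φ[p] p) (fieldInChart N p (φ[p] p)) =
      a • fderiv ℝ (f ∘ φ[p].symm) (φ[p] p))
    {X : Model n} (hX : fderiv ℝ (f ∘ φ[p].symm) (φ[p] p) X = 0) :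
    covDerivForm g N p X X = a * chartHessian f p X X +
      (1 / 2 * fderiv ℝ (chartMetric g p) (φ[p] p) (fieldInChart N p (φ[p] p)) X X -
        fderiv ℝ (chartMetric g p) (φ[p] p) X (fieldInChart N p (φ[p] p)) X) := by
  have hG := differentiableAt_chartMetric g p
  have hν : DifferentiableAt ℝ (fieldInChart N p) (φ[p] p) :=
    (contDiffAt_fieldInChart (hN.contMDiffOn.contMDiffAt
      (hN.isOpen.mem_nhds hp.2))).differentiableAt (by simp)
  have hη := fderiv_apply_of_eventually_conormal (hf.self_of_nhds.contDiffAt (m := 2))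
    hf.self_of_nhds.fderiv_ne_zero (hG.clm_apply hν) (hN.eventually_conormal hp hf) ha hX
  rw [fderiv_clm_apply hG hν] at hη
  have hη' : fderiv ℝ (chartMetric g p) (φ[p] p) X (fieldInChart N p (φ[p] p)) X +
      chartMetric g p (φ[p] p) (fderiv ℝ (fieldInChart N p) (φ[p] p) X) X =
        a * chartHessian f p X X := (add_comm _ _).trans hη
  rw [covDerivForm_apply]
  linarith

theorem IsFutureUnitNormalOn.exists_covDerivForm_sub_eq (hN : IsFutureUnitNormalOn T S U N)
    (hN' : IsFutureUnitNormalOn T F U' N') (hp : p ∈ S ∩ U) (hp' : p ∈ F ∩ U') (hNN' : N p = N' p)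
    (hf : ∀ᶠ q in 𝓝 p, IsDefiningFunctionAt (n := n) S q f)
    (hk : ∀ᶠ q in 𝓝 p, IsDefiningFunctionAt (n := n) F q k)
    (hκ : fderiv ℝ (k ∘ φ[p].symm) (φ[p] p) = κ • fderiv ℝ (f ∘ φ[p].symm) (φ[p] p)) :
    ∃ a : ℝ, a * fderiv ℝ (k ∘ φ[p].symm) (φ[p] p) (T.field p) < 0 ∧
      ∀ X, fderiv ℝ (f ∘ φ[p].symm) (φ[p] p) X = 0 →
        covDerivForm g N p X X - covDerivForm g N' p X X =
          a * (κ * chartHessian f p X X - chartHessian k p X X) := by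
  have hν : fieldInChart N p (φ[p] p) = fieldInChart N' p (φ[p] p) := by
    rw [fieldInChart_self, fieldInChart_self, hNN']
  obtain ⟨a, ha⟩ := exists_eq_smul_of_forall_apply_eq_zero
    ((hN'.eventually_conormal hp' hk).self_of_nhds rfl)
  refine ⟨a, ?_, fun X hX ↦ ?_⟩
  · have hT := hN'.future p hp'
    rw [fieldInChart_self, chartMetric_self] at ha
    have haT := DFunLike.congr_fun ha (T.field p)
    exact haT.symm.trans_lt hT
  · rw [hN.covDerivForm_self hp hf (a := a * κ) (by rw [hν, ha, hκ, smul_smul]) hX,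
      hN'.covDerivForm_self hp' hk ha (by rw [hκ, smul_apply, hX, smul_zero]),
      hν]
    ring

theorem HasMeanCurvatureAt.exists_eq_neg_sum_covDerivForm {H : ℝ}
    (hH : HasMeanCurvatureAt T S p H) (hp : p ∈ S)
    (hf : IsDefiningFunctionAt (n := n) S p f) :
    ∃ (U : Set M) (N : ∀ q : M, TangentSpace (𝓡 (n + 1)) q) (e : Fin n → Model n),
      p ∈ U ∧ IsFutureUnitNormalOn T S U N ∧
      (∀ i, fderiv ℝ (f ∘ φ[p].symm) (φ[p] p) (e i) = 0) ∧
      (∀ i j, chartMetric g p (φ[p] p) (e i) (e j) = if i = j then 1 else 0) ∧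
      H = -∑ i, covDerivForm g N p (e i) (e i) := by
  obtain ⟨U, N, e, hpU, hN, he, horth, rfl⟩ := hH
  refine ⟨U, N, e, hpU, hN, fun i ↦ (hf.isTangentTo_iff hp).1 (he i), ?_, ?_⟩
  · rwa [chartMetric_self]
  · rw [← Finset.sum_neg_distrib]
    exact Finset.sum_congr rfl fun i _ ↦ congrArg Neg.neg (covDeriv_self g N p (e i))

theorem HasMeanCurvatureAt.mul_sub_nonneg_of_isLocalMaxOn {c θ : ℝ}
    (hc : HasMeanCurvatureAt T S p c) (hθ : HasMeanCurvatureAt T F p θ)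
    (hS : IsSpacelikeHypersurface g S) (hp : p ∈ S) (hp' : p ∈ F)
    (hk : ∀ᶠ q in 𝓝 p, IsDefiningFunctionAt (n := n) F q k) (hmax : IsLocalMaxOn k S p) :
    0 ≤ fderiv ℝ (k ∘ φ[p].symm) (φ[p] p) (T.field p) * (c - θ) := by
  obtain ⟨f, hf⟩ := hS.1.exists_eventually_isDefiningFunctionAt hp
  have hfp := hf.self_of_nhds
  have hkp := hk.self_of_nhds
  have hlevel := hfp.isLocalMaxOn_level hp hmax
  obtain ⟨κ, hκ⟩ := fderiv_eq_smul_of_isLocalExtrOn_level hfp.contDiffAt hfp.fderiv_ne_zero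
    (hkp.contDiffAt.differentiableAt one_ne_zero) (Or.inr hlevel)
  have hκ0 : κ ≠ 0 := fun h ↦ hkp.fderiv_ne_zero (by rw [hκ, h, zero_smul])
  have hker (v : Model n) : fderiv ℝ (f ∘ φ[p].symm) (φ[p] p) v = 0 ↔
      fderiv ℝ (k ∘ φ[p].symm) (φ[p] p) v = 0 := by
    rw [hκ, smul_apply, smul_eq_zero_iff_right hκ0]
  obtain ⟨U, N, e, hpU, hN, he, horth, rfl⟩ := hc.exists_eq_neg_sum_covDerivForm hp hfp
  obtain ⟨U', N', e', hpU', hN', he', horth', rfl⟩ := hθ.exists_eq_neg_sum_covDerivForm hp' hkp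
  have hNN' : N p = N' p := hN.eq_of_isTangentTo_iff hN' hS ⟨hp, hpU⟩ ⟨hp', hpU'⟩ fun v ↦
    (hfp.isTangentTo_iff hp).trans ((hker v).trans (hkp.isTangentTo_iff hp').symm)
  obtain ⟨a, ha, hsub⟩ :=
    hN.exists_covDerivForm_sub_eq hN' ⟨hp, hpU⟩ ⟨hp', hpU'⟩ hNN' hf hk hκ
  have hess (i : Fin n) : chartHessian k p (e i) (e i) ≤ κ * chartHessian f p (e i) (e i) :=
    snd_fderiv_apply_le_of_isLocalMaxOn_level hfp.contDiffAt hfp.fderiv_ne_zero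
      hkp.contDiffAt hlevel hκ (he i)
  have htrace : ∑ i, covDerivForm g N' p (e i) (e i) = ∑ i, covDerivForm g N' p (e' i) (e' i) :=
    sum_apply_self_eq_of_mem_ker (by simp)
      (ContinuousLinearMap.coe_injective.ne hkp.fderiv_ne_zero)
      (G := (chartMetric g p (φ[p] p)).toBilinForm) (covDerivForm g N' p).toBilinForm
      (fun i ↦ (hker _).1 (he i)) he' horth horth'
  rw [← htrace, neg_sub_neg, ← neg_sub, ← Finset.sum_sub_distrib,
    Finset.sum_congr rfl fun i _ ↦ hsub _ (he i), ← Finset.mul_sum]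
  have hsum := Finset.sum_nonneg fun i (_ : i ∈ Finset.univ) ↦ sub_nonneg.2 (hess i)
  nlinarith

end Comparison

section Submersions

variable {𝕜 E E' H H' M N : Type*} [NontriviallyNormedField 𝕜] [NormedAddCommGroup E]
  [NormedSpace 𝕜 E] [NormedAddCommGroup E'] [NormedSpace 𝕜 E'] [TopologicalSpace H]
  [TopologicalSpace H'] {I : ModelWithCorners 𝕜 E H} {J : ModelWithCorners 𝕜 E' H'}
  [TopologicalSpace M] [ChartedSpace H M] [TopologicalSpace N] [ChartedSpace H' N] {m : ℕ∞ω}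

theorem mdifferentiable_of_mem_maximalAtlas [IsManifold I 1 M] {e : OpenPartialHomeomorph M H}
    (he : e ∈ IsManifold.maximalAtlas I 1 M) : e.MDifferentiable I I :=
  ⟨fun _ hx ↦ (mdifferentiableAt_of_mem_maximalAtlas he hx).mdifferentiableWithinAt,
    fun _ hx ↦ (mdifferentiableAt_symm_of_mem_maximalAtlas he hx).mdifferentiableWithinAt⟩

theorem surjective_mfderiv_of_isSubmersionAt [IsManifold I m M] [IsManifold J m N] {f : M → N}
    {x : M} (hf : IsSubmersionAt I J m f x) (hm : 1 ≤ m) :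
    Function.Surjective (mfderiv I J f x) := by
  have := IsManifold.of_le (I := I) (M := M) hm
  have := IsManifold.of_le (I := J) (M := N) hm
  have hφ := mdifferentiable_of_mem_maximalAtlas
    (IsManifold.maximalAtlas_subset_of_le hm hf.domChart_mem_maximalAtlas)
  have hψ := mdifferentiable_of_mem_maximalAtlas
    (IsManifold.maximalAtlas_subset_of_le hm hf.codChart_mem_maximalAtlas)
  have hfd := (hf.contMDiffAt.mdifferentiableAt (by positivity)).hasMFDerivAt
  have hψf := (J.hasMFDerivAt (x := hf.codChart (f x))).comp x
    ((hψ.mdifferentiableAt hf.mem_codChart_source).hasMFDerivAt.comp x hfd)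
  have hπφ := (ContinuousLinearMap.fst 𝕜 E' hf.complement ∘L
    (hf.equiv : E →L[𝕜] E' × hf.complement)).hasMFDerivAt.comp x
    ((I.hasMFDerivAt (x := hf.domChart x)).comp x
      (hφ.mdifferentiableAt hf.mem_domChart_source).hasMFDerivAt)
  have heq : (J ∘ hf.codChart ∘ f) =ᶠ[𝓝 x] (Prod.fst ∘ hf.equiv) ∘ I ∘ hf.domChart := by
    filter_upwards [hf.domChart.open_source.mem_nhds hf.mem_domChart_source] with y hy
    have := hf.writtenInCharts ((hf.domChart.extend I).map_source (by simpa using hy))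
    simpa [hy] using this
  have hderiv := hasMFDerivAt_unique hψf (hπφ.congr_of_eventuallyEq heq)
  intro w
  obtain ⟨v, hv⟩ := hφ.mfderiv_surjective hf.mem_domChart_source
    (hf.equiv.symm (mfderiv J J hf.codChart (f x) w, 0))
  refine ⟨v, hψ.mfderiv_injective hf.mem_codChart_source ?_⟩
  exact (DFunLike.congr_fun hderiv v).trans
    (congrArg Prod.fst ((congrArg hf.equiv hv).trans (hf.equiv.apply_symm_apply _)))

end Submersions

/-! ### The local flow of a vector field -/

section LocalFlow

variable {E : Type*} [NormedAddCommGroup E] [NormedSpace ℝ E]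

theorem exists_localSolution_of_contDiffAt [CompleteSpace E] {f : E → E} {x₀ : E} {U : Set E}
    (hf : ContDiffAt ℝ 1 f x₀) (hU : U ∈ 𝓝 x₀) :
    ∃ V ∈ 𝓝 x₀, ∃ ε > 0, ∃ α : E × ℝ → E, ContinuousOn α (V ×ˢ Ioo (-ε) ε) ∧ ∀ x ∈ V,
      α (x, 0) = x ∧ ∀ t ∈ Ioo (-ε) ε,
        α (x, t) ∈ U ∧ HasDerivAt (fun s ↦ α (x, s)) (f (α (x, t))) t := by
  obtain ⟨ε, hε, a, r, L, K, hr, hpl⟩ := IsPicardLindelof.of_contDiffAt_one hf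
  obtain ⟨α, hα, hαc⟩ := (hpl 0).exists_forall_mem_closedBall_eq_hasDerivWithinAt_continuousOn
  simp only [zero_sub, zero_add] at hα hαc
  have hnhds : Metric.closedBall x₀ r ×ˢ Ioo (-ε) ε ∈ 𝓝 (x₀, (0 : ℝ)) :=
    prod_mem_nhds (Metric.closedBall_mem_nhds _ hr) (Ioo_mem_nhds (neg_lt_zero.2 hε) hε)
  have hαU : ∀ᶠ z in 𝓝 (x₀, (0 : ℝ)), α z ∈ U := by
    refine (hαc.continuousAt (mem_of_superset hnhds ?_)).eventually (eventually_mem_set.2 ?_)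
    · exact prod_mono_right Ioo_subset_Icc_self
    · rwa [(hα _ (Metric.mem_closedBall_self r.2)).1]
  obtain ⟨δ, hδ, hball⟩ := Metric.eventually_nhds_iff_ball.1 (hαU.and hnhds)
  rw [← ball_prod_same, Real.ball_eq_Ioo, zero_sub, zero_add] at hball
  refine ⟨_, Metric.ball_mem_nhds x₀ hδ, δ, hδ, α, ?_, fun x hx ↦ ⟨?_, fun t ht ↦ ?_⟩⟩
  · exact hαc.mono fun z hz ↦ prod_mono_right Ioo_subset_Icc_self (hball z hz).2
  · exact (hα _ (hball (x, 0) ⟨hx, neg_lt_zero.2 hδ, hδ⟩).2.1).1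
  · obtain ⟨hxU, hxr, htε⟩ := hball (x, t) ⟨hx, ht⟩
    exact ⟨hxU, ((hα x hxr).2 t (Ioo_subset_Icc_self htε)).hasDerivAt (Icc_mem_nhds htε.1 htε.2)⟩

variable {H : Type*} [TopologicalSpace H] {I : ModelWithCorners ℝ E H}
  {M : Type*} [TopologicalSpace M] [ChartedSpace H M]

local notation "φ[" p "]" => extChartAt I p

variable {X : ∀ q : M, TangentSpace I q}

theorem hasDerivAt_comp_of_isMIntegralCurveOn {γ : ℝ → M} {J : Set ℝ} {f : M → ℝ} {t : ℝ}
    (hγ : IsMIntegralCurveOn γ X J) (ht : J ∈ 𝓝 t) (hf : MDifferentiableAt I 𝓘(ℝ, ℝ) f (γ t)) :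
    HasDerivAt (f ∘ γ) (mfderiv I 𝓘(ℝ, ℝ) f (γ t) (X (γ t))) t := by
  have hcomp := (hf.hasMFDerivAt.comp t ((hγ t (mem_of_mem_nhds ht)).hasMFDerivAt ht)).hasFDerivAt
  have hderiv (A : ℝ →L[ℝ] ℝ) (hA : HasFDerivAt (f ∘ γ) A t) : HasDerivAt (f ∘ γ) (A 1) t :=
    hA.hasDerivAt
  refine (hderiv _ hcomp).congr_deriv ?_
  exact congrArg (mfderiv I 𝓘(ℝ, ℝ) f (γ t)) (one_smul ℝ (X (γ t)))

theorem velocity_eq_of_isMIntegralCurveOn {n : ℕ} {M : Type*} [TopologicalSpace M]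
    [ChartedSpace (Model n) M] {X : ∀ q : M, TangentSpace (𝓡 (n + 1)) q} {γ : ℝ → M} {J : Set ℝ}
    (hγ : IsMIntegralCurveOn γ X J) {t : ℝ} (ht : J ∈ 𝓝 t) : velocity n γ t = X (γ t) :=
  (DFunLike.congr_fun ((hγ t (mem_of_mem_nhds ht)).hasMFDerivAt ht).mfderiv (1 : ℝ)).trans
    (one_smul ℝ (X (γ t)))

variable (I) in
/-- The vector field `X` in the chart at `p`. -/
noncomputable def chartField [IsManifold I 1 M] (X : ∀ q : M, TangentSpace I q) (p : M)
    (x : E) : E :=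
  tangentCoordChange I (φ[p].symm x) p (φ[p].symm x) (X (φ[p].symm x))

variable [IsManifold I 1 M]

theorem hasMFDerivAt_chart_symm_comp {p : M} {β : ℝ → E} {t : ℝ} (hβ : β t ∈ interior φ[p].target)
    (hβ' : HasDerivAt β (chartField I X p (β t)) t) :
    HasMFDerivAt 𝓘(ℝ, ℝ) I (φ[p].symm ∘ β) t
      ((1 : ℝ →L[ℝ] ℝ).smulRight (X (φ[p].symm (β t)))) := by
  have hmem := interior_subset hβ
  have hp : φ[p].symm (β t) ∈ φ[p].source := φ[p].map_target hmem
  have hself := mem_extChartAt_source (I := I) (φ[p].symm (β t))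
  have hint : range I ∈ 𝓝 (β t) :=
    mem_of_superset (mem_interior_iff_mem_nhds.1 hβ) (extChartAt_target_subset_range p)
  have hcoord := hasFDerivWithinAt_tangentCoordChange (I := I) ⟨hp, hself⟩
  rw [φ[p].right_inv hmem] at hcoord
  have hderiv : HasDerivAt ((φ[φ[p].symm (β t)] ∘ φ[p].symm) ∘ β)
      (X (φ[p].symm (β t)) : E) t := by
    refine ((hcoord.hasFDerivAt hint).comp_hasDerivAt t hβ').congr_deriv ?_
    exact (tangentCoordChange_comp ⟨⟨hself, hp⟩, hself⟩).trans (tangentCoordChange_self hself)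
  refine ⟨(continuousAt_extChartAt_symm'' hmem).comp hβ'.continuousAt, ?_⟩
  have := hderiv.hasFDerivAt.hasFDerivWithinAt (s := univ)
  simpa only [mfld_simps] using! this

/-- A continuous local flow `Φ` of the vector field `X`: the curve `Φ y` is the integral curve of
`X` starting at `y`, for all `y` in the open set `W`, and it is defined for time `ε`. -/
structure IsLocalFlow (X : ∀ q : M, TangentSpace I q) (W : Set M) (ε : ℝ) (Φ : M → ℝ → M) :
    Prop where
  isOpen : IsOpen W
  pos : 0 < ε
  apply_zero : ∀ y ∈ W, Φ y 0 = y
  isMIntegralCurveOn : ∀ y ∈ W, IsMIntegralCurveOn (Φ y) X (Ioo (-ε) ε)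
  continuousOn : ContinuousOn (Function.uncurry Φ) (W ×ˢ Ioo (-ε) ε)

theorem exists_isLocalFlow [CompleteSpace E] [BoundarylessManifold I M] {p : M}
    (hX : ContMDiffAt I I.tangent 1 (fun q : M ↦ (⟨q, X q⟩ : TangentBundle I M)) p) :
    ∃ (W : Set M) (ε : ℝ) (Φ : M → ℝ → M), IsLocalFlow X W ε Φ ∧ p ∈ W := by
  have hp : I.IsInteriorPoint p := BoundarylessManifold.isInteriorPoint
  have hfield : ContDiffAt ℝ 1 (chartField I X p) (φ[p] p) :=
    ((contMDiffAt_iff.1 hX).2.contDiffAt (range_mem_nhds_isInteriorPoint hp)).snd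
  obtain ⟨V, hV, ε, hε, α, hαc, hα⟩ := exists_localSolution_of_contDiffAt hfield
    (isOpen_interior.mem_nhds (I.isInteriorPoint_iff.1 hp))
  have hsource : ∀ y ∈ φ[p].source ∩ φ[p] ⁻¹' interior V, φ[p] y ∈ V :=
    fun y hy ↦ interior_subset hy.2
  refine ⟨φ[p].source ∩ φ[p] ⁻¹' interior V, ε, fun y t ↦ φ[p].symm (α (φ[p] y, t)),
    ⟨?_, hε, fun y hy ↦ ?_, fun y hy t ht ↦ ?_, ?_⟩, ?_⟩
  · exact (continuousOn_extChartAt p).isOpen_inter_preimage (isOpen_extChartAt_source p)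
      isOpen_interior
  · rw [(hα _ (hsource y hy)).1, φ[p].left_inv hy.1]
  · obtain ⟨hmem, hderiv⟩ := (hα _ (hsource y hy)).2 t ht
    exact (hasMFDerivAt_chart_symm_comp hmem hderiv).hasMFDerivWithinAt
  · refine (continuousOn_extChartAt_symm p).comp (hαc.comp ?_ fun z hz ↦ ?_) fun z hz ↦ ?_
    · exact ((continuousOn_extChartAt p).comp continuousOn_fst fun z hz ↦ hz.1.1).prodMk
        continuousOn_snd
    · exact ⟨hsource z.1 hz.1, hz.2⟩
    · exact interior_subset ((hα _ (hsource z.1 hz.1)).2 z.2 hz.2).1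
  · exact ⟨mem_extChartAt_source p, mem_interior_iff_mem_nhds.2 hV⟩

theorem contMDiffOn_of_isMIntegralCurveOn
    (hX : Continuous fun q : M ↦ (⟨q, X q⟩ : TangentBundle I M)) {γ : ℝ → M} {J : Set ℝ}
    (hJ : IsOpen J) (hγ : IsMIntegralCurveOn γ X J) : ContMDiffOn 𝓘(ℝ, ℝ) I 1 γ J := by
  intro t ht
  have hcont : ∀ s ∈ J, ContinuousAt γ s := fun s hs ↦ hγ.continuousOn.continuousAt (hJ.mem_nhds hs)
  refine (contMDiffAt_iff.2 ⟨hcont t ht, ?_⟩).contMDiffWithinAt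
  have hderiv : ∀ᶠ s in 𝓝 t, s ∈ J ∧ γ s ∈ φ[γ t].source :=
    (hJ.eventually_mem ht).and ((hcont t ht).eventually (extChartAt_source_mem_nhds (γ t)))
  suffices ContDiffAt ℝ 1 (φ[γ t] ∘ γ) t by simpa using! this
  rw [contDiffAt_one_iff]
  refine ⟨fun s ↦ ContinuousLinearMap.toSpanSingleton ℝ
    (tangentCoordChange I (γ s) (γ t) (γ s) (X (γ s))), _, hderiv, ?_, ?_⟩
  · rintro s ⟨hs, hsource⟩
    let e := trivializationAt E (TangentSpace I) (γ t)
    have hmem : (⟨γ s, X (γ s)⟩ : TangentBundle I M) ∈ e.source := by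
      rwa [e.mem_source, TangentBundle.trivializationAt_baseSet, ← extChartAt_source I]
    have hcoord : ContinuousAt (fun r ↦ (e ⟨γ r, X (γ r)⟩).2) s :=
      ContinuousAt.snd (ContinuousAt.comp (f := fun r ↦ (⟨γ r, X (γ r)⟩ : TangentBundle I M))
        (e.continuousAt hmem) (hX.continuousAt.comp (hcont s hs)))
    exact ((ContinuousLinearMap.toSpanSingletonCLE (𝕜 := ℝ)
      (E := E)).continuous.continuousAt.comp hcoord).continuousWithinAt
  · rintro s ⟨hs, hsource⟩
    exact ((hγ.hasDerivWithinAt hs hsource).hasDerivAt (hJ.mem_nhds hs)).hasFDerivAt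

end LocalFlow

/-! ### The global flow of a vector field -/

section Flow

variable {E : Type*} [NormedAddCommGroup E] [NormedSpace ℝ E] {H : Type*} [TopologicalSpace H]
  {I : ModelWithCorners ℝ E H} {M : Type*} [TopologicalSpace M] [ChartedSpace H M]
  {X : ∀ q : M, TangentSpace I q}

/-- The integral curve of `X` starting at `x` is at `y` at time `t`: the flow of `X` as a
relation, which avoids choosing a curve or its domain. -/
def FlowsTo (X : ∀ q : M, TangentSpace I q) (t : ℝ) (x y : M) : Prop :=
  ∃ (γ : ℝ → M) (a b : ℝ), IsMIntegralCurveOn γ X (Ioo a b) ∧ 0 ∈ Ioo a b ∧ t ∈ Ioo a b ∧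
    γ 0 = x ∧ γ t = y

theorem flowsTo_of_isMIntegralCurveOn {γ : ℝ → M} {a b s t : ℝ}
    (hγ : IsMIntegralCurveOn γ X (Ioo a b)) (hs : s ∈ Ioo a b) (ht : t ∈ Ioo a b) :
    FlowsTo X (t - s) (γ s) (γ t) := by
  refine ⟨_, a - s, b - s, (hγ.comp_add s).mono fun r hr ↦ ?_, ?_, ?_, ?_, ?_⟩
  · exact ⟨by linarith [hr.1], by linarith [hr.2]⟩
  · exact ⟨by linarith [hs.1], by linarith [hs.2]⟩
  · exact ⟨by linarith [ht.1], by linarith [ht.2]⟩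
  · simp
  · simp

theorem IsLocalFlow.flowsTo {W : Set M} {ε : ℝ} {Φ : M → ℝ → M} (hΦ : IsLocalFlow X W ε Φ) {y : M}
    (hy : y ∈ W) {t : ℝ} (ht : t ∈ Ioo (-ε) ε) : FlowsTo X t y (Φ y t) :=
  ⟨Φ y, -ε, ε, hΦ.isMIntegralCurveOn y hy, ⟨neg_lt_zero.2 hΦ.pos, hΦ.pos⟩, ht, hΦ.apply_zero y hy,
    rfl⟩

theorem FlowsTo.symm {t : ℝ} {x y : M} (h : FlowsTo X t x y) : FlowsTo X (-t) y x := by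
  obtain ⟨γ, a, b, hγ, h0, ht, rfl, rfl⟩ := h
  simpa using flowsTo_of_isMIntegralCurveOn hγ ht h0

/-- The set of times up to which the integral curve of `X` starting at `x` is defined. -/
def flowDomain (X : ∀ q : M, TangentSpace I q) (x : M) : Set ℝ :=
  {t | ∃ y, FlowsTo X t x y}

open Classical in
/-- The maximal integral curve of `X` starting at `x`, with the junk value `x` outside of
`flowDomain X x`. -/
noncomputable def flow (X : ∀ q : M, TangentSpace I q) (x : M) (t : ℝ) : M :=
  if h : t ∈ flowDomain X x then h.choose else x

theorem FlowsTo.mem_flowDomain {t : ℝ} {x y : M} (h : FlowsTo X t x y) : t ∈ flowDomain X x :=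
  ⟨y, h⟩

theorem flowsTo_flow {t : ℝ} {x : M} (ht : t ∈ flowDomain X x) : FlowsTo X t x (flow X x t) := by
  rw [flow, dif_pos ht]
  exact ht.choose_spec

theorem subset_flowDomain {γ : ℝ → M} {a b : ℝ} (hγ : IsMIntegralCurveOn γ X (Ioo a b))
    (h0 : 0 ∈ Ioo a b) : Ioo a b ⊆ flowDomain X (γ 0) :=
  fun t ht ↦ ⟨γ t, γ, a, b, hγ, h0, ht, rfl, rfl⟩

theorem isOpen_flowDomain (x : M) : IsOpen (flowDomain X x) := by
  refine isOpen_iff_mem_nhds.2 ?_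
  rintro t ⟨-, γ, a, b, hγ, h0, ht, rfl, rfl⟩
  exact mem_of_superset (isOpen_Ioo.mem_nhds ht) (subset_flowDomain hγ h0)

theorem ordConnected_flowDomain (x : M) : (flowDomain X x).OrdConnected := by
  refine ordConnected_of_uIcc_subset_left (x := 0) ?_
  rintro t ⟨-, γ, a, b, hγ, h0, ht, rfl, rfl⟩
  exact (ordConnected_Ioo.uIcc_subset h0 ht).trans (subset_flowDomain hγ h0)

variable [IsManifold I 1 M]

theorem flowsTo_zero [CompleteSpace E] [BoundarylessManifold I M] {x : M}
    (hX : ContMDiffAt I I.tangent 1 (fun q : M ↦ (⟨q, X q⟩ : TangentBundle I M)) x) :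
    FlowsTo X 0 x x := by
  obtain ⟨W, ε, Φ, hΦ, hx⟩ := exists_isLocalFlow hX
  simpa only [hΦ.apply_zero x hx] using hΦ.flowsTo hx ⟨neg_lt_zero.2 hΦ.pos, hΦ.pos⟩

variable [BoundarylessManifold I M] [T2Space M]
  (hX : ContMDiff I I.tangent 1 (fun q : M ↦ (⟨q, X q⟩ : TangentBundle I M)))
include hX

theorem FlowsTo.unique {t : ℝ} {x y z : M} (hy : FlowsTo X t x y) (hz : FlowsTo X t x z) :
    y = z := by
  obtain ⟨γ, a, b, hγ, h0, ht, hx, rfl⟩ := hy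
  obtain ⟨γ', a', b', hγ', h0', ht', hx', rfl⟩ := hz
  exact isMIntegralCurveOn_Ioo_eqOn_of_contMDiff_boundaryless (t₀ := 0)
    ⟨max_lt h0.1 h0'.1, lt_min h0.2 h0'.2⟩ hX
    (hγ.mono (Ioo_subset_Ioo (le_max_left _ _) (min_le_left _ _)))
    (hγ'.mono (Ioo_subset_Ioo (le_max_right _ _) (min_le_right _ _))) (hx.trans hx'.symm)
    ⟨max_lt ht.1 ht'.1, lt_min ht.2 ht'.2⟩

theorem FlowsTo.trans {s t : ℝ} {x y z : M} (hxy : FlowsTo X s x y) (hyz : FlowsTo X t y z) :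
    FlowsTo X (s + t) x z := by
  classical
  obtain ⟨γ, a, b, hγ, h0, hs, rfl, rfl⟩ := hxy
  obtain ⟨γ', a', b', hγ', h0', ht, hy, rfl⟩ := hyz
  have hshift : IsMIntegralCurveOn (γ' ∘ (· + -s)) X (Ioo (a' + s) (b' + s)) :=
    (hγ'.comp_add (-s)).mono fun r hr ↦ ⟨by linarith [hr.1], by linarith [hr.2]⟩
  have hs' : s ∈ Ioo (a' + s) (b' + s) := ⟨by linarith [h0'.1], by linarith [h0'.2]⟩
  have ht' : s + t ∈ Ioo (a' + s) (b' + s) := ⟨by linarith [ht.1], by linarith [ht.2]⟩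
  have hglue : γ s = (γ' ∘ (· + -s)) s := by simp [hy]
  have hIoo : Ioo (min a (a' + s)) (max b (b' + s)) ⊆ Ioo a b ∪ Ioo (a' + s) (b' + s) := by
    rw [Ioo_union_Ioo' (hs'.1.trans hs.2) (hs.1.trans hs'.2)]
  refine ⟨piecewise (Ioo a b) γ (γ' ∘ (· + -s)), _, _,
    (isMIntegralCurveOn_piecewise hX hγ hshift ⟨hs, hs'⟩ hglue).mono hIoo,
    ⟨min_lt_of_left_lt h0.1, lt_max_of_lt_left h0.2⟩,
    ⟨min_lt_of_right_lt ht'.1, lt_max_of_lt_right ht'.2⟩, piecewise_eqOn _ _ _ h0, ?_⟩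
  rw [eqOn_piecewise_of_isMIntegralCurveOn_Ioo hX hγ hshift ⟨hs, hs'⟩ hglue ht']
  simp

theorem FlowsTo.flow_eq {t : ℝ} {x y : M} (h : FlowsTo X t x y) : flow X x t = y :=
  (flowsTo_flow h.mem_flowDomain).unique hX h

theorem isMIntegralCurveOn_flow (x : M) : IsMIntegralCurveOn (flow X x) X (flowDomain X x) := by
  rintro t ⟨-, γ, a, b, hγ, h0, ht, rfl, rfl⟩
  have heq : EqOn (flow X (γ 0)) γ (Ioo a b) := fun s hs ↦ FlowsTo.flow_eq hX
    ⟨γ, a, b, hγ, h0, hs, rfl, rfl⟩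
  have hderiv := (hγ t ht).hasMFDerivAt (Ioo_mem_nhds ht.1 ht.2)
  rw [← heq ht] at hderiv
  exact (hderiv.congr_of_eventuallyEq (heq.eventuallyEq_of_mem (Ioo_mem_nhds ht.1 ht.2)))
    |>.hasMFDerivWithinAt

theorem flow_add {x : M} {s t : ℝ} (hs : s ∈ flowDomain X x) (ht : t ∈ flowDomain X (flow X x s)) :
    s + t ∈ flowDomain X x ∧ flow X x (s + t) = flow X (flow X x s) t :=
  have h := (flowsTo_flow hs).trans hX (flowsTo_flow ht)
  ⟨h.mem_flowDomain, h.flow_eq hX⟩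

theorem IsLocalFlow.flow_eq {W : Set M} {ε : ℝ} {Φ : M → ℝ → M} (hΦ : IsLocalFlow X W ε Φ) {y : M}
    (hy : y ∈ W) {t : ℝ} (ht : t ∈ Ioo (-ε) ε) : t ∈ flowDomain X y ∧ flow X y t = Φ y t :=
  ⟨(hΦ.flowsTo hy ht).mem_flowDomain, (hΦ.flowsTo hy ht).flow_eq hX⟩

end Flow

section FlowContinuity

variable {E : Type*} [NormedAddCommGroup E] [NormedSpace ℝ E] {H : Type*} [TopologicalSpace H]
  {I : ModelWithCorners ℝ E H} {M : Type*} [TopologicalSpace M] [ChartedSpace H M]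
  {X : ∀ q : M, TangentSpace I q}

/-- Near `x` and near the time `t`, the flow of `X` is defined and continuous. -/
structure FlowContinuousAt (X : ∀ q : M, TangentSpace I q) (x : M) (t : ℝ) : Prop where
  eventually_mem : ∀ᶠ z in 𝓝 (x, t), z.2 ∈ flowDomain X z.1
  continuousAt : ContinuousAt (Function.uncurry (flow X)) (x, t)

variable [IsManifold I 1 M] [BoundarylessManifold I M] [T2Space M]
  (hX : ContMDiff I I.tangent 1 (fun q : M ↦ (⟨q, X q⟩ : TangentBundle I M)))
include hX

theorem IsLocalFlow.flowContinuousAt {W : Set M} {ε : ℝ} {Φ : M → ℝ → M}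
    (hΦ : IsLocalFlow X W ε Φ) {y : M} (hy : y ∈ W) {t : ℝ} (ht : t ∈ Ioo (-ε) ε) :
    FlowContinuousAt X y t := by
  have hnhds : W ×ˢ Ioo (-ε) ε ∈ 𝓝 (y, t) := (hΦ.isOpen.prod isOpen_Ioo).mem_nhds ⟨hy, ht⟩
  have heq : ∀ᶠ z in 𝓝 (y, t), z.2 ∈ flowDomain X z.1 ∧ flow X z.1 z.2 = Φ z.1 z.2 :=
    eventually_of_mem hnhds fun z hz ↦ hΦ.flow_eq hX hz.1 hz.2
  exact ⟨heq.mono fun z hz ↦ hz.1,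
    (hΦ.continuousOn.continuousAt hnhds).congr (heq.mono fun z hz ↦ hz.2.symm)⟩

theorem FlowContinuousAt.add {x : M} {s t : ℝ} (hs : FlowContinuousAt X x s)
    (ht : FlowContinuousAt X (flow X x s) t) : FlowContinuousAt X x (s + t) := by
  have hshift : Tendsto (fun z : M × ℝ ↦ (z.1, z.2 - t)) (𝓝 (x, s + t)) (𝓝 (x, s)) := by
    have : ContinuousAt (fun z : M × ℝ ↦ (z.1, z.2 - t)) (x, s + t) := by fun_prop
    simpa only [ContinuousAt, add_sub_cancel_right] using this
  have hstep : Tendsto (fun z : M × ℝ ↦ (flow X z.1 (z.2 - t), t)) (𝓝 (x, s + t))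
      (𝓝 (flow X x s, t)) :=
    (hs.continuousAt.tendsto.comp hshift).prodMk_nhds tendsto_const_nhds
  have hadd : ∀ᶠ z in 𝓝 (x, s + t), z.2 ∈ flowDomain X z.1 ∧
      flow X z.1 z.2 = flow X (flow X z.1 (z.2 - t)) t := by
    filter_upwards [hshift.eventually hs.eventually_mem, hstep.eventually ht.eventually_mem]
      with z hz hz'
    simpa only [sub_add_cancel] using flow_add hX hz hz'
  refine ⟨hadd.mono fun z hz ↦ hz.1, ?_⟩
  rw [ContinuousAt, Function.uncurry_apply_pair,
    (hadd.self_of_nhds.2 : flow X x (s + t) = _), add_sub_cancel_right]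
  exact (ht.continuousAt.tendsto.comp hstep).congr' (hadd.mono fun z hz ↦ hz.2.symm)

variable [CompleteSpace E]

theorem flowContinuousAt_of_mem_flowDomain {x : M} {t : ℝ} (ht : t ∈ flowDomain X x) :
    FlowContinuousAt X x t := by
  have h0 := flowsTo_zero (hX x)
  have hcont : ∀ s ∈ flowDomain X x, ContinuousAt (flow X x) s := fun s hs ↦
    (isMIntegralCurveOn_flow hX x).continuousOn.continuousAt ((isOpen_flowDomain x).mem_nhds hs)
  suffices ∀ s ∈ flowDomain X x, ∀ᶠ u in 𝓝[flowDomain X x] s,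
      FlowContinuousAt X (flow X x s) (u - s) ∧ FlowContinuousAt X (flow X x u) (s - u) by
    have hchain := (ordConnected_flowDomain x).isPreconnected.induction₂'
      (fun s u ↦ FlowContinuousAt X (flow X x s) (u - s)) this ?_ h0.mem_flowDomain ht
    · simpa only [h0.flow_eq hX, sub_zero] using hchain
    · intro s u v hs _ _ hsu huv
      have hflow := (flow_add hX hs hsu.eventually_mem.self_of_nhds).2
      rw [add_sub_cancel] at hflow
      rw [hflow] at huv
      simpa only [add_comm (u - s), sub_add_sub_cancel] using hsu.add hX huv
  intro s hs
  obtain ⟨W, ε, Φ, hΦ, hW⟩ := exists_isLocalFlow (hX (flow X x s))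
  filter_upwards [nhdsWithin_le_nhds ((hcont s hs).eventually (hΦ.isOpen.mem_nhds hW)),
    nhdsWithin_le_nhds (Ioo_mem_nhds (sub_lt_self s hΦ.pos) (lt_add_of_pos_right s hΦ.pos))]
    with u hu hus
  exact ⟨hΦ.flowContinuousAt hX hW ⟨by linarith [hus.1], by linarith [hus.2]⟩,
    hΦ.flowContinuousAt hX hu ⟨by linarith [hus.2], by linarith [hus.1]⟩⟩

end FlowContinuity

section FlowLimits

variable {E : Type*} [NormedAddCommGroup E] [NormedSpace ℝ E] {H : Type*} [TopologicalSpace H]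
  {I : ModelWithCorners ℝ E H} {M : Type*} [TopologicalSpace M] [ChartedSpace H M]
  {X : ∀ q : M, TangentSpace I q} {W : Set M} {ε : ℝ} {Φ : M → ℝ → M}

theorem IsLocalFlow.field_eq_zero [IsManifold I 1 M] (hΦ : IsLocalFlow X W ε Φ) {p : M}
    (hp : p ∈ W) {t : ℝ} (ht : t ∈ Ioo (-ε) ε) (hconst : ∀ᶠ s in 𝓝 t, Φ p s = p) : X p = 0 := by
  have hderiv := (hΦ.isMIntegralCurveOn p hp t ht).hasMFDerivAt (Ioo_mem_nhds ht.1 ht.2)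
  rw [hconst.self_of_nhds] at hderiv
  have heq : (fun _ ↦ p) =ᶠ[𝓝 t] Φ p := hconst.mono fun s hs ↦ hs.symm
  have hzero := (hderiv.congr_of_eventuallyEq heq).mfderiv.symm.trans mfderiv_const
  exact (one_smul ℝ (X p)).symm.trans (DFunLike.congr_fun hzero (1 : ℝ))

variable [IsManifold I 1 M] [BoundarylessManifold I M] [T2Space M]
  (hX : ContMDiff I I.tangent 1 (fun q : M ↦ (⟨q, X q⟩ : TangentBundle I M)))
include hX

theorem IsLocalFlow.apply_eq_of_tendsto_flow (hΦ : IsLocalFlow X W ε Φ) {p x : M} (hp : p ∈ W)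
    {l : Filter (flowDomain X x)} [l.NeBot] {s : ℝ} (hs : s ∈ Ioo (-ε) ε)
    (hlim : Tendsto (fun t : flowDomain X x ↦ flow X x t) l (𝓝 p))
    (hshift : ∀ A ∈ l, ∀ᶠ t : flowDomain X x in l, ∀ u : flowDomain X x,
      (u : ℝ) = t + s → u ∈ A) : Φ p s = p := by
  have hcont : ContinuousAt (fun y ↦ Φ y s) p := by
    have hΦc : ContinuousAt (Function.uncurry Φ) (p, s) :=
      hΦ.continuousOn.continuousAt ((hΦ.isOpen.prod isOpen_Ioo).mem_nhds ⟨hp, hs⟩)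
    exact ContinuousAt.comp (f := fun y ↦ (y, s)) hΦc (by fun_prop)
  refine tendsto_nhds_unique (hcont.tendsto.comp hlim) (tendsto_def.2 fun V hV ↦ ?_)
  filter_upwards [hlim.eventually (hΦ.isOpen.mem_nhds hp), hshift _ (hlim hV)] with t ht ht'
  obtain ⟨hmem, heq⟩ := hΦ.flow_eq hX ht hs
  obtain ⟨hmem', heq'⟩ := flow_add hX t.2 hmem
  simpa only [mem_preimage, Function.comp_apply, heq', heq] using ht' ⟨t + s, hmem'⟩ rfl

theorem not_tendsto_flow [CompleteSpace E] (hX0 : ∀ p, X p ≠ 0) {p x : M}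
    {l : Filter (flowDomain X x)} [l.NeBot] {J : Set ℝ} (hJ : IsOpen J) (h0 : 0 ∈ closure J)
    (hshift : ∀ s ∈ J, ∀ A ∈ l, ∀ᶠ t : flowDomain X x in l, ∀ u : flowDomain X x,
      (u : ℝ) = t + s → u ∈ A) : ¬ Tendsto (fun t : flowDomain X x ↦ flow X x t) l (𝓝 p) := by
  intro hlim
  obtain ⟨W, ε, Φ, hΦ, hp⟩ := exists_isLocalFlow (hX p)
  obtain ⟨s, hs, hsJ⟩ := mem_closure_iff.1 h0 _ isOpen_Ioo ⟨neg_lt_zero.2 hΦ.pos, hΦ.pos⟩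
  refine hX0 p (hΦ.field_eq_zero hp hs ?_)
  filter_upwards [Ioo_mem_nhds hs.1 hs.2, hJ.mem_nhds hsJ] with r hr hrJ
  exact hΦ.apply_eq_of_tendsto_flow hX hp hr hlim (hshift r hrJ)

theorem isInextendible_flow [CompleteSpace E] (hX0 : ∀ p, X p ≠ 0) (x : M) :
    IsInextendible (flow X x) (flowDomain X x) := by
  have : Nonempty (flowDomain X x) := ⟨0, (flowsTo_zero (hX x)).mem_flowDomain⟩
  constructor
  · rintro ⟨p, hp⟩
    refine not_tendsto_flow hX hX0 (isOpen_Ioi (a := 0)) (by simp) (fun s hs A hA ↦ ?_) hp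
    obtain ⟨a, ha⟩ := mem_atTop_sets.1 hA
    filter_upwards [mem_atTop a] with t ht u hu
    exact ha u (Subtype.coe_le_coe.1 (by linarith [mem_Ioi.1 hs, Subtype.coe_le_coe.2 ht]))
  · rintro ⟨p, hp⟩
    refine not_tendsto_flow hX hX0 (isOpen_Iio (a := 0)) (by simp) (fun s hs A hA ↦ ?_) hp
    obtain ⟨a, ha⟩ := mem_atBot_sets.1 hA
    filter_upwards [mem_atBot a] with t ht u hu
    exact ha u (Subtype.coe_le_coe.1 (by linarith [mem_Iio.1 hs, Subtype.coe_le_coe.2 ht]))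

end FlowLimits

section Transversality

theorem eventually_exists_eq_zero_of_hasDerivAt {Y : Type*} [TopologicalSpace Y] {h : Y → ℝ → ℝ}
    {x : Y} {t c : ℝ} (hc : c ≠ 0) (hderiv : HasDerivAt (h x) c t) (hzero : h x t = 0)
    (hcont : ∀ᶠ z in 𝓝 (x, t), ContinuousAt (Function.uncurry h) z) {U : Set (Y × ℝ)}
    (hU : U ∈ 𝓝 (x, t)) : ∀ᶠ y in 𝓝 x, ∃ s, (y, s) ∈ U ∧ h y s = 0 := by
  wlog hpos : 0 < c generalizing h c
  · have hneg := this (h := fun y s ↦ -h y s) (neg_ne_zero.2 hc) hderiv.neg (by simpa using hzero)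
      (hcont.mono fun z hz ↦ hz.neg) (neg_pos.2 (hc.lt_of_le (not_lt.1 hpos)))
    simpa only [neg_eq_zero] using hneg
  have hsign : ∀ᶠ s in 𝓝 t, SignType.sign (h x s) = SignType.sign (s - t) :=
    eventually_nhdsWithin_sign_eq_of_deriv_pos (hderiv.deriv.symm ▸ hpos) hzero
  obtain ⟨A, hA, B, hB, hAB⟩ := mem_nhds_prod_iff.1 (hcont.and hU)
  obtain ⟨r, hr, hball⟩ := Metric.mem_nhds_iff.1 (inter_mem hB hsign)
  rw [Real.ball_eq_Ioo] at hball
  have hmem (s : ℝ) (hs : s ∈ Icc (t - r / 2) (t + r / 2)) :=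
    hball (⟨by linarith [hs.1], by linarith [hs.2]⟩ : s ∈ Ioo (t - r) (t + r))
  have hle : t - r / 2 ≤ t + r / 2 := by linarith
  have hslice (y : Y) (hy : y ∈ A) (s : ℝ) (hs : s ∈ Icc (t - r / 2) (t + r / 2)) :
      ContinuousAt (Function.uncurry h) (y, s) := (hAB ⟨hy, (hmem s hs).1⟩).1
  have hleft : h x (t - r / 2) < 0 := by
    rw [← sign_eq_neg_one_iff, (hmem _ (left_mem_Icc.2 hle)).2, sign_eq_neg_one_iff]
    linarith
  have hright : 0 < h x (t + r / 2) := by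
    rw [← sign_eq_one_iff, (hmem _ (right_mem_Icc.2 hle)).2, sign_eq_one_iff]
    linarith
  have hcontx (s : ℝ) (hs : s ∈ Icc (t - r / 2) (t + r / 2)) : ContinuousAt (fun y ↦ h y s) x :=
    ContinuousAt.comp (f := fun y ↦ (y, s)) (hslice x (mem_of_mem_nhds hA) s hs) (by fun_prop)
  filter_upwards [hA, (hcontx _ (left_mem_Icc.2 hle)).eventually_lt_const hleft,
    (hcontx _ (right_mem_Icc.2 hle)).eventually_const_lt hright] with y hy hyl hyr
  have hconty : ContinuousOn (h y) (Icc (t - r / 2) (t + r / 2)) := fun s hs ↦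
    (ContinuousAt.comp (f := fun s ↦ (y, s)) (hslice y hy s hs) (by fun_prop)).continuousWithinAt
  obtain ⟨s, hs, hs0⟩ := intermediate_value_Icc hle hconty ⟨hyl.le, hyr.le⟩
  exact ⟨s, (hAB ⟨hy, (hmem s hs).1⟩).2, hs0⟩

variable {n : ℕ} {M : Type*} [TopologicalSpace M] [T2Space M]
  [ChartedSpace (Model n) M] [IsManifold (𝓡 (n + 1)) ∞ M]
  {X : ∀ q : M, TangentSpace (𝓡 (n + 1)) q}

theorem eventually_exists_flow_mem
    (hX : ContMDiff (𝓡 (n + 1)) (𝓡 (n + 1)).tangent 1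
      (fun q : M ↦ (⟨q, X q⟩ : TangentBundle (𝓡 (n + 1)) M)))
    {S : Set M} {x : M} {t : ℝ} (ht : t ∈ flowDomain X x) (hS : flow X x t ∈ S) {f : M → ℝ}
    (hf : IsDefiningFunctionAt (n := n) S (flow X x t) f)
    (hfX : mfderiv (𝓡 (n + 1)) 𝓘(ℝ, ℝ) f (flow X x t) (X (flow X x t)) ≠ (0 : ℝ))
    {N : Set ℝ} (hN : N ∈ 𝓝 t) :
    ∀ᶠ y in 𝓝 x, ∃ s ∈ N, s ∈ flowDomain X y ∧ flow X y s ∈ S := by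
  have hderiv := hasDerivAt_comp_of_isMIntegralCurveOn (isMIntegralCurveOn_flow hX x)
    ((isOpen_flowDomain x).mem_nhds ht) hf.mdifferentiableAt
  have hflow : ∀ᶠ z in 𝓝 (x, t), FlowContinuousAt X z.1 z.2 :=
    (flowContinuousAt_of_mem_flowDomain hX ht).eventually_mem.mono fun z hz ↦
      flowContinuousAt_of_mem_flowDomain hX hz
  have htendsto := hflow.self_of_nhds.continuousAt.tendsto
  have hfcont : ∀ᶠ q in 𝓝 (flow X x t), ContinuousAt f q :=
    ((contMDiffAt_iff_contMDiffAt_nhds (n := 1) (by simp)).1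
      (hf.contMDiffAt.of_le (mod_cast le_top))).mono fun q hq ↦ hq.continuousAt
  have hcont : ∀ᶠ z in 𝓝 (x, t), ContinuousAt (fun z : M × ℝ ↦ f (flow X z.1 z.2)) z := by
    filter_upwards [hflow, htendsto.eventually hfcont] with z hz hz'
    exact ContinuousAt.comp hz' hz.continuousAt
  have hU : ∀ᶠ z in 𝓝 (x, t), z.2 ∈ N ∧ z.2 ∈ flowDomain X z.1 ∧
      (flow X z.1 z.2 ∈ S ↔ f (flow X z.1 z.2) = 0) :=
    (continuousAt_snd.eventually (eventually_mem_set.2 hN)).and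
      (hflow.self_of_nhds.eventually_mem.and (htendsto.eventually hf.mem_iff))
  filter_upwards [eventually_exists_eq_zero_of_hasDerivAt (h := fun y s ↦ f (flow X y s)) hfX hderiv
    (hf.apply_eq_zero hS) hcont hU] with y ⟨s, ⟨hsN, hs, hmem⟩, hs0⟩
  exact ⟨s, hsN, hs, hmem.2 hs0⟩

end Transversality

/-! ### Cauchy surfaces and time functions -/

section Orbits

variable {E : Type*} [NormedAddCommGroup E] [NormedSpace ℝ E] {H : Type*} [TopologicalSpace H]
  {I : ModelWithCorners ℝ E H} {M : Type*} [TopologicalSpace M] [ChartedSpace H M]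
  {X : ∀ q : M, TangentSpace I q} {x y z : M}

/-- Two points lie on a common integral curve of `X`. -/
def SameOrbit (X : ∀ q : M, TangentSpace I q) (x y : M) : Prop :=
  ∃ t, FlowsTo X t x y

/-- The union of the orbits of `X` that meet `S`. -/
def saturation (X : ∀ q : M, TangentSpace I q) (S : Set M) : Set M :=
  {x | ∃ y ∈ S, SameOrbit X x y}

theorem SameOrbit.symm : SameOrbit X x y → SameOrbit X y x :=
  fun ⟨t, ht⟩ ↦ ⟨-t, ht.symm⟩

theorem SameOrbit.trans [IsManifold I 1 M] [BoundarylessManifold I M] [T2Space M]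
    (hX : ContMDiff I I.tangent 1 (fun q : M ↦ (⟨q, X q⟩ : TangentBundle I M))) :
    SameOrbit X x y → SameOrbit X y z → SameOrbit X x z :=
  fun ⟨s, hs⟩ ⟨t, ht⟩ ↦ ⟨s + t, hs.trans hX ht⟩

theorem hasMFDerivAt_mul_sub_const {τ : M → ℝ} {p : M} {τ' : TangentSpace I p →L[ℝ] ℝ}
    (hτ : HasMFDerivAt I 𝓘(ℝ, ℝ) τ p τ') (a θ : ℝ) :
    HasMFDerivAt I 𝓘(ℝ, ℝ) (fun q ↦ a * (τ q - θ)) p (a • τ') := by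
  have haffine : HasFDerivAt (fun x : ℝ ↦ a * (x - θ)) (a • ContinuousLinearMap.id ℝ ℝ) (τ p) :=
    ((hasFDerivAt_id (τ p)).sub_const θ).const_mul a
  exact haffine.hasMFDerivAt.comp p hτ

end Orbits

section TimeOrientation

variable {n : ℕ} {M : Type*} [TopologicalSpace M] [ChartedSpace (Model n) M]
  [IsManifold (𝓡 (n + 1)) ∞ M] {g : LorentzianMetric n M} {T : TimeOrientation g}

theorem TimeOrientation.contMDiff_one (T : TimeOrientation g) :
    ContMDiff (𝓡 (n + 1)) (𝓡 (n + 1)).tangent 1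
      (fun q : M ↦ (⟨q, T.field q⟩ : TangentBundle (𝓡 (n + 1)) M)) :=
  T.contMDiff.of_le (mod_cast le_top)

theorem TimeOrientation.field_ne_zero (T : TimeOrientation g) (p : M) : T.field p ≠ 0 := fun h ↦
  (T.timelike p).ne (by rw [h, map_zero])

theorem TimeOrientation.isFutureTimelikeCurve {γ : ℝ → M} {J : Set ℝ} (hJ : IsOpen J)
    (hJ' : J.OrdConnected) (hne : J.Nonempty) (hγ : IsMIntegralCurveOn γ T.field J) :
    IsFutureTimelikeCurve T γ J := by
  refine ⟨⟨hJ, hJ', hne, contMDiffOn_of_isMIntegralCurveOn T.contMDiff.continuous hJ hγ⟩,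
    fun t ht ↦ ?_⟩
  rw [velocity_eq_of_isMIntegralCurveOn hγ (hJ.mem_nhds ht)]
  exact ⟨T.timelike _, T.timelike _⟩

theorem IsFutureTimelikeCurve.isCausalCurve {γ : ℝ → M} {J : Set ℝ}
    (hγ : IsFutureTimelikeCurve T γ J) : IsCausalCurve g γ J := by
  refine ⟨hγ.1, fun t ht ↦ ⟨fun h ↦ (hγ.2 t ht).1.ne ?_, (hγ.2 t ht).1.le⟩⟩
  rw [h, map_zero]

theorem IsSpacelikeHypersurface.mfderiv_field_ne_zero (T : TimeOrientation g) {S : Set M}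
    (hS : IsSpacelikeHypersurface g S) {p : M} (hp : p ∈ S) {f : M → ℝ}
    (hf : IsDefiningFunctionAt (n := n) S p f) :
    mfderiv (𝓡 (n + 1)) 𝓘(ℝ, ℝ) f p (T.field p) ≠ (0 : ℝ) := fun h ↦
  (hS.2 p hp _ ((hf.isTangentTo_iff_mfderiv hp).2 h) (T.field_ne_zero p)).not_gt (T.timelike p)

end TimeOrientation

section TimeFunctions

variable {n : ℕ} {M : Type*} [TopologicalSpace M] [ChartedSpace (Model n) M]
  [IsManifold (𝓡 (n + 1)) ∞ M] {g : LorentzianMetric n M} {T : TimeOrientation g} {τ : M → ℝ}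

theorem IsTimeFunction.mdifferentiableAt (hτ : IsTimeFunction T τ) (p : M) :
    MDifferentiableAt (𝓡 (n + 1)) 𝓘(ℝ, ℝ) τ p :=
  (hτ.1.contMDiff p).mdifferentiableAt (by simp)

theorem IsTimeFunction.strictMonoOn (hτ : IsTimeFunction T τ) {γ : ℝ → M} {a b : ℝ} (hab : a < b)
    (hγ : IsMIntegralCurveOn γ T.field (Ioo a b)) : StrictMonoOn (τ ∘ γ) (Ioo a b) :=
  hτ.2 γ _ (T.isFutureTimelikeCurve isOpen_Ioo ordConnected_Ioo (nonempty_Ioo.2 hab) hγ)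

theorem IsTimeFunction.eq_of_sameOrbit (hτ : IsTimeFunction T τ) {x y : M}
    (hxy : SameOrbit T.field x y) (h : τ x = τ y) : x = y := by
  obtain ⟨t, γ, a, b, hγ, h0, ht, rfl, rfl⟩ := hxy
  exact congrArg γ ((hτ.strictMonoOn (h0.1.trans h0.2) hγ).injOn h0 ht h)

theorem IsTimeFunction.isDefiningFunctionAt (hτ : IsTimeFunction T τ) {a : ℝ} (ha : a ≠ 0)
    (θ : ℝ) (p : M) :
    IsDefiningFunctionAt (n := n) (τ ⁻¹' {θ}) p (fun q ↦ a * (τ q - θ)) := by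
  refine ⟨contMDiffAt_const.mul ((hτ.1.contMDiff p).sub contMDiffAt_const),
    .of_forall fun q ↦ by simp [ha, sub_eq_zero], fun h ↦ ?_⟩
  obtain ⟨v, hv⟩ := surjective_mfderiv_of_isSubmersionAt (hτ.1.isSubmersionAt p) (by simp) (1 : ℝ)
  have hderiv := hasMFDerivAt_mul_sub_const (hτ.mdifferentiableAt p).hasMFDerivAt a θ
  have hav : a * 1 = 0 := hv ▸ DFunLike.congr_fun (hderiv.mfderiv.symm.trans h) v
  exact ha ((mul_one a).symm.trans hav)

theorem IsTimeFunction.mfderiv_field_nonneg (hτ : IsTimeFunction T τ) (p : M) :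
    (0 : ℝ) ≤ mfderiv (𝓡 (n + 1)) 𝓘(ℝ, ℝ) τ p (T.field p) := by
  obtain ⟨W, ε, Φ, hΦ, hp⟩ := exists_isLocalFlow (T.contMDiff_one p)
  have h0 : (0 : ℝ) ∈ Ioo (-ε) ε := ⟨neg_lt_zero.2 hΦ.pos, hΦ.pos⟩
  have hγ := hΦ.isMIntegralCurveOn p hp
  have hderiv := hasDerivAt_comp_of_isMIntegralCurveOn hγ (isOpen_Ioo.mem_nhds h0)
    (hτ.mdifferentiableAt (Φ p 0))
  rw [hΦ.apply_zero p hp] at hderiv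
  have hacc : AccPt (0 : ℝ) (𝓟 (Ioo (-ε) ε)) := by
    simpa using (PerfectSpace.univ_preperfect (0 : ℝ) (mem_univ _)).nhds_inter
      (isOpen_Ioo.mem_nhds h0)
  exact hderiv.hasDerivWithinAt.nonneg_of_monotoneOn hacc
    (hτ.strictMonoOn (h0.1.trans h0.2) hγ).monotoneOn

theorem IsCMCTimeFunction.mfderiv_field_pos (hτ : IsCMCTimeFunction T τ) (p : M) :
    (0 : ℝ) < mfderiv (𝓡 (n + 1)) 𝓘(ℝ, ℝ) τ p (T.field p) := by
  refine (hτ.1.mfderiv_field_nonneg p).lt_of_ne fun h ↦ ?_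
  refine (hτ.2 (τ p)).1.mfderiv_field_ne_zero T rfl
    (hτ.1.isDefiningFunctionAt one_ne_zero (τ p) p) ?_
  rw [(hasMFDerivAt_mul_sub_const (hτ.1.mdifferentiableAt p).hasMFDerivAt 1 (τ p)).mfderiv]
  exact (one_mul _).trans h.symm

theorem IsCMCTimeFunction.mul_sub_nonneg_of_isLocalMaxOn (hτ : IsCMCTimeFunction T τ) {S : Set M}
    {c : ℝ} (hS : HasConstantMeanCurvature T S c) {p : M} (hp : p ∈ S) {a : ℝ} (ha : a ≠ 0)
    (hmax : IsLocalMaxOn (fun q ↦ a * τ q) S p) : 0 ≤ a * (c - τ p) := by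
  have hk (q : M) := hτ.1.isDefiningFunctionAt ha (τ p) q
  have hmax' : IsLocalMaxOn (fun q ↦ a * (τ q - τ p)) S p := by
    filter_upwards [hmax] with q hq
    linarith
  have hnonneg := (hS.2 p hp).mul_sub_nonneg_of_isLocalMaxOn ((hτ.2 (τ p)).2 p rfl) hS.1 hp rfl
    (.of_forall hk) hmax'
  have hderiv := hasMFDerivAt_mul_sub_const (hτ.1.mdifferentiableAt p).hasMFDerivAt a (τ p)
  rw [fderiv_comp_chart_symm_self hderiv.mdifferentiableAt, hderiv.mfderiv] at hnonneg
  exact nonneg_of_mul_nonneg_left (hnonneg.trans_eq (mul_right_comm a _ _))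
    (hτ.mfderiv_field_pos p)

theorem IsCMCTimeFunction.eqOn_const (hτ : IsCMCTimeFunction T τ) {S : Set M} (hcomp : IsCompact S)
    {c : ℝ} (hS : HasConstantMeanCurvature T S c) : EqOn τ (fun _ ↦ c) S := by
  intro x hx
  have hcont : ContinuousOn τ S := hτ.1.1.contMDiff.continuous.continuousOn
  obtain ⟨p, hp, hmax⟩ := hcomp.exists_isMaxOn ⟨x, hx⟩ hcont
  obtain ⟨q, hq, hmin⟩ := hcomp.exists_isMinOn ⟨x, hx⟩ hcont
  have hpc : 0 ≤ 1 * (c - τ p) := hτ.mul_sub_nonneg_of_isLocalMaxOn hS hp one_ne_zero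
    (by simpa using hmax.localize)
  have hqc : 0 ≤ -1 * (c - τ q) := hτ.mul_sub_nonneg_of_isLocalMaxOn hS hq (by norm_num)
    (by simpa using hmin.localize.neg)
  exact le_antisymm ((hmax hx).trans (by linarith)) (le_trans (by linarith) (hmin hx))

end TimeFunctions

section CauchySurfaces

variable {n : ℕ} {M : Type*} [TopologicalSpace M] [T2Space M] [ChartedSpace (Model n) M]
  [IsManifold (𝓡 (n + 1)) ∞ M] {g : LorentzianMetric n M} (T : TimeOrientation g) {S C : Set M}

theorem IsSpacelikeHypersurface.eventually_exists_flow_mem (hS : IsSpacelikeHypersurface g S)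
    {x : M} {t : ℝ} (ht : t ∈ flowDomain T.field x) (hx : flow T.field x t ∈ S) {N : Set ℝ}
    (hN : N ∈ 𝓝 t) : ∀ᶠ y in 𝓝 x, ∃ s ∈ N, s ∈ flowDomain T.field y ∧ flow T.field y s ∈ S := by
  obtain ⟨f, hf⟩ := hS.1.exists_eventually_isDefiningFunctionAt hx
  have hf := hf.self_of_nhds
  exact Spacetime.eventually_exists_flow_mem T.contMDiff_one ht hx hf
    (hS.mfderiv_field_ne_zero T hx hf) hN

theorem IsSpacelikeHypersurface.isOpen_saturation (hS : IsSpacelikeHypersurface g S) :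
    IsOpen (saturation T.field S) := by
  refine isOpen_iff_mem_nhds.2 ?_
  rintro x ⟨y, hy, t, ht⟩
  obtain rfl := ht.flow_eq T.contMDiff_one
  filter_upwards [hS.eventually_exists_flow_mem T ht.mem_flowDomain hy univ_mem]
    with z ⟨s, _, hs, hz⟩
  exact ⟨_, hz, s, flowsTo_flow hs⟩

theorem IsCauchySurface.existsUnique_flow_mem (hC : IsCauchySurface g C) (x : M) :
    ∃! t, t ∈ flowDomain T.field x ∧ flow T.field x t ∈ C :=
  hC.2 _ _ (T.isFutureTimelikeCurve (isOpen_flowDomain x) (ordConnected_flowDomain x)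
      ⟨0, (flowsTo_zero (T.contMDiff_one x)).mem_flowDomain⟩
      (isMIntegralCurveOn_flow T.contMDiff_one x)).isCausalCurve
    (isInextendible_flow T.contMDiff_one T.field_ne_zero x)

theorem IsCauchySurface.exists_continuous_projection (hC : IsCauchySurface g C) :
    ∃ r : M → M, Continuous r ∧ ∀ x y, r x = y ↔ y ∈ C ∧ SameOrbit T.field x y := by
  choose t ht huniq using hC.existsUnique_flow_mem T
  refine ⟨fun x ↦ flow T.field x (t x), continuous_iff_continuousAt.2 fun x ↦ ?_, fun x y ↦ ?_⟩
  · have htcont : ContinuousAt t x := by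
      refine tendsto_def.2 fun N hN ↦ ?_
      filter_upwards [hC.1.eventually_exists_flow_mem T (ht x).1 (ht x).2 hN]
        with y ⟨s, hsN, hs⟩
      exact mem_preimage.2 (huniq y s hs ▸ hsN)
    exact ContinuousAt.comp (f := fun y ↦ (y, t y))
      (flowContinuousAt_of_mem_flowDomain T.contMDiff_one (ht x).1).continuousAt
      (continuousAt_id.prodMk htcont)
  · constructor
    · rintro rfl
      exact ⟨(ht x).2, t x, flowsTo_flow (ht x).1⟩
    · rintro ⟨hy, s, hs⟩
      have hflow := hs.flow_eq T.contMDiff_one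
      change flow T.field x (t x) = y
      rw [← huniq x s ⟨hs.mem_flowDomain, hflow ▸ hy⟩, hflow]

theorem IsCauchySurface.isClosed_saturation (hC : IsCauchySurface g C) (hS : IsCompact S) :
    IsClosed (saturation T.field S) := by
  obtain ⟨r, hr, hrC⟩ := hC.exists_continuous_projection T
  have hr_mem (x : M) := (hrC x (r x)).1 rfl
  have hsat : saturation T.field S = r ⁻¹' (r '' S) := by
    ext x
    constructor
    · rintro ⟨y, hy, hxy⟩
      exact ⟨y, hy, ((hrC x (r y)).2 ⟨(hr_mem y).1, hxy.trans T.contMDiff_one (hr_mem y).2⟩).symm⟩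
    · rintro ⟨y, hy, hxy⟩
      exact ⟨y, hy, (hr_mem x).2.trans T.contMDiff_one (hxy ▸ (hr_mem y).2.symm)⟩
  exact hsat ▸ (hS.image hr).isClosed.preimage hr

theorem IsCauchySurface.saturation_eq_univ [PreconnectedSpace M] (hC : IsCauchySurface g C)
    (hS : IsSpacelikeHypersurface g S) (hcomp : IsCompact S) (hne : S.Nonempty) :
    saturation T.field S = univ := by
  obtain ⟨p, hp⟩ := hne
  exact IsClopen.eq_univ ⟨hC.isClosed_saturation T hcomp, hS.isOpen_saturation T⟩
    ⟨p, p, hp, 0, flowsTo_zero (T.contMDiff_one p)⟩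

end CauchySurfaces

end Spacetime

theorem propositionp_general {n : ℕ} {M : Type*} [TopologicalSpace M] [T2Space M]
    [PreconnectedSpace M] [ChartedSpace (Spacetime.Model n) M] [IsManifold (𝓡 (n + 1)) ∞ M]
    {g : Spacetime.LorentzianMetric n M} {T : Spacetime.TimeOrientation g} {C : Set M}
    (hC : Spacetime.IsCauchySurface g C) {τ : M → ℝ} (hτ : Spacetime.IsCMCTimeFunction T τ)
    {S : Set M} (hS_compact : IsCompact S) (hS_nonempty : S.Nonempty) {c : ℝ}
    (hS : Spacetime.HasConstantMeanCurvature T S c) : S = τ ⁻¹' {c} := by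
  have hτS := hτ.eqOn_const hS_compact hS
  refine Subset.antisymm hτS fun x hx ↦ ?_
  have hx_sat : x ∈ Spacetime.saturation T.field S :=
    hC.saturation_eq_univ T hS.1 hS_compact hS_nonempty ▸ mem_univ x
  obtain ⟨y, hy, hxy⟩ := hx_sat
  exact hτ.1.eq_of_sameOrbit hxy (Eq.trans hx (hτS hy).symm) ▸ hy

theorem propositionp {n : ℕ} {M : Type*} [TopologicalSpace M] [T2Space M]
    [SecondCountableTopology M] [ConnectedSpace M]
    [ChartedSpace (Spacetime.Model n) M] [IsManifold (𝓡 (n + 1)) ∞ M]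
    (g : Spacetime.LorentzianMetric n M) (T : Spacetime.TimeOrientation g)
    (hM : ∃ S : Set M, Spacetime.IsCauchySurface g S ∧ IsCompact S)
    (τ : M → ℝ) (hτ : Spacetime.IsCMCTimeFunction T τ)
    (S : Set M) (hS_compact : IsCompact S) (hS_nonempty : S.Nonempty)
    (hS : ∃ c : ℝ, Spacetime.HasConstantMeanCurvature T S c) :
    ∃ θ : ℝ, S = τ ⁻¹' {θ} := by
  obtain ⟨c, hc⟩ := hS
  obtain ⟨C, hC, -⟩ := hM
  exact ⟨c, propositionp_general hC hτ hS_compact hS_nonempty hc⟩
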